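/- **Setting.** Let $H$ be a complex Hilbert space and $T$ a self-adjoint operator in $H$ whose spectrum is a set of eigenvalues $\{t_k\}_{k\ge 1}$, $t_1<t_2<\dots$, with eigenvectors $T\phi_k=t_k\phi_k$ that form an orthonormal basis $\{\phi_k\}_{k\ge1}$ of $H$. Let $p\ge 1$ be an integer and $d>0$ a real number with $t_{k+p}-t_k>d$ for all $k\ge1$. Let $B$ be a closed operator in $H$ with $\operatorname{dom}B\supseteq\operatorname{dom}T$, put $L=T+B$ (with domain $\operatorname{dom}T$), $R^0(z)=(z-T)^{-1}$, $\beta_k=\|B\phi_k\|^2$, $\|\beta\|_\infty=\sup_k\beta_k$, and suppose that $$\limsup_{k\to\infty}\beta_k<\Big(\frac d{2p}\Big)^2\frac1{8p(1+\pi^2/3)}.\tag{1}$$ **Clusters.** For $k\ge1$ let $\gamma(k)$ be the least $j\ge0$ with $t_{k+j+1}-t_{k+j}\ge d/p$ (so $\gamma(k)\le p-1$). Put $j_1=1$, $j_2=1+\gamma(1)$, $j_{k+1}=(j_k+1)+\gamma(j_k+1)$ for $k\ge2$, and $T_k=t_{j_k}$. Let $F_1=[T_1-\frac d{2p},T_2+\frac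 d{2p}]$, $F_k=[T_k+\frac d{2p},T_{k+1}+\frac d{2p}]$ for $k\ge2$, and $\Pi_k=\{a+ib: a\in F_k,\ |b|\le\frac d{2p}\}$ for $k\ge1$. **Parameters.** Consider integers $M,N\ge0$ and a real number $h>0$ such that $$\beta_k\le\Big(\frac d{2p}\Big)^2\frac1{8p(1+\pi^2/3)}\ \ (k\ge M),\qquad \|\beta\|_\infty\le\frac{d^2}{16p^2}\Big(2p\sum_{j=N+1}^\infty\frac1{j^2}\Big)^{-1},\qquad \sum_{j=0}^\infty\frac1{h^2+(jd/2p)^2}\le\frac1{8p\|\beta\|_\infty}\tag{2}$$ (the last condition holds for every $h>0$ if $\beta=0$). Put $K=M+N$ and $$\Pi_0=\{a+ib:\ \min(0,t_1)-h\le a\le T_{K+1}+\tfrac d{2p},\ |b|\le h\}.$$ **Proposition A.** Numbers $M,N,h$ that satisfy (2) exist. For all such $M,N,h$, the spectrum of $L$ is discrete, that is, it has no accumulation point in $\mathbb C$ and consists of isolated eigenvalues of finite algebraic multiplicity, and $$\operatorname{Sp}L\subset\Pi_0\cup\bigcup_{j=K+1}^\infty\Pi_j .$$ Moreover every $z\notin\Pi_0\cup\bigcup_{j>K}\Pi_j$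 lies in the resolvent set of $T$, and $\|BR^0(z)\|\le\frac12$. -/

import Mathlib

open Filter Topology

noncomputable section

namespace SpectralPerturbation

variable {H : Type*} [NormedAddCommGroup H] [InnerProductSpace ℂ H]

/-! ### Spectral theory of an unbounded operator -/

/-- `R` is a bounded two-sided inverse of `z - A : dom A → H`. -/
def IsResolventAt (A : H →ₗ.[ℂ] H) (z : ℂ) (R : H →L[ℂ] H) : Prop :=
  (∀ f : H, ∃ hf : R f ∈ A.domain, z • R f - A ⟨R f, hf⟩ = f) ∧
    ∀ u : A.domain, R (z • (u : H) - A u) = u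

/-- The resolvent set of `A`. -/
def resolventSet (A : H →ₗ.[ℂ] H) : Set ℂ :=
  {z | ∃ R : H →L[ℂ] H, IsResolventAt A z R}

/-- The spectrum `Sp A`. -/
def Sp (A : H →ₗ.[ℂ] H) : Set ℂ := (resolventSet A)ᶜ

open Classical in
/-- The resolvent `(z - A)⁻¹` for `z ∉ Sp A` (and `0` for `z ∈ Sp A`). -/
def resolvent (A : H →ₗ.[ℂ] H) (z : ℂ) : H →L[ℂ] H :=
  if hz : z ∈ resolventSet A then hz.choose else 0

theorem isResolventAt_resolvent {A : H →ₗ.[ℂ] H} {z : ℂ} (hz : z ∈ resolventSet A) :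
    IsResolventAt A z (resolvent A z) := by
  simp only [resolvent, dif_pos hz]
  exact hz.choose_spec

/-- The operator `(2πi)⁻¹ ∮ (w - A)⁻¹ dw` over the circle of centre `z` and radius `r`. It is the
Riesz projection of `z` when `z` is the only point of `Sp A` in the closed disc. -/
def rieszProjection (A : H →ₗ.[ℂ] H) (z : ℂ) (r : ℝ) : H →L[ℂ] H :=
  (2 * (Real.pi : ℂ) * Complex.I)⁻¹ • ∮ w in C(z, r), resolvent A w

/-- The spectrum of `A` is discrete: it has no accumulation point in `ℂ`, and each of its points is
an isolated eigenvalue of finite algebraic multiplicity (the rank of its Riesz projection). -/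
def HasDiscreteSpectrum (A : H →ₗ.[ℂ] H) : Prop :=
  (∀ z : ℂ, ∃ r : ℝ, 0 < r ∧ Metric.closedBall z r ∩ Sp A ⊆ {z}) ∧
    ∀ z ∈ Sp A,
      (∃ u : A.domain, (u : H) ≠ 0 ∧ A u = z • (u : H)) ∧
      ∃ r : ℝ, 0 < r ∧ Metric.closedBall z r ∩ Sp A = {z} ∧
        FiniteDimensional ℂ (LinearMap.range (rieszProjection A z r).toLinearMap)

/-! ### Clusters of eigenvalues

The sequence is `t 1, t 2, …`; the value `t 0` is never used. -/

/-- `γ(k)`: the least `j ≥ 0` with `t (k+j+1) - t (k+j) ≥ d/p`. -/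
def gam (t : ℕ → ℝ) (p : ℕ) (d : ℝ) (k : ℕ) : ℕ :=
  sInf {j : ℕ | d / p ≤ t (k + j + 1) - t (k + j)}

/-- The indices `j_k`, `k ≥ 1`: `j_1 = 1`, and for `k ≥ 2`, `j_k` is the index of the last
eigenvalue of the `(k-1)`-st cluster. The first cluster starts at the index `1`, the next one always
at the index that follows the last index of the previous one, and a cluster that starts at the index
`s` ends at `s + γ(s)`. (The value at `0` is never used.) -/
def clusterIdx (t : ℕ → ℝ) (p : ℕ) (d : ℝ) : ℕ → ℕ
  | 0 => 0
  | 1 => 1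
  | 2 => 1 + gam t p d 1
  | k + 3 => clusterIdx t p d (k + 2) + 1 + gam t p d (clusterIdx t p d (k + 2) + 1)

/-- `T_k = t_{j_k}`. -/
def clusterPt (t : ℕ → ℝ) (p : ℕ) (d : ℝ) (k : ℕ) : ℝ := t (clusterIdx t p d k)

/-- The intervals `F_1 = [T_1 - d/2p, T_2 + d/2p]` and `F_k = [T_k + d/2p, T_{k+1} + d/2p]` for
`k > 1`. -/
def clusterInterval (t : ℕ → ℝ) (p : ℕ) (d : ℝ) (k : ℕ) : Set ℝ :=
  if k = 1 then
    Set.Icc (clusterPt t p d 1 - d / (2 * p)) (clusterPt t p d 2 + d / (2 * p))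
  else
    Set.Icc (clusterPt t p d k + d / (2 * p)) (clusterPt t p d (k + 1) + d / (2 * p))

/-- The rectangle `Π_k` (`k ≥ 1`) around the `k`-th cluster. -/
def clusterRect (t : ℕ → ℝ) (p : ℕ) (d : ℝ) (k : ℕ) : Set ℂ :=
  {z | z.re ∈ clusterInterval t p d k ∧ |z.im| ≤ d / (2 * p)}

/-- The rectangle `Π_0`. Its left edge is at `-h` if `t_1 ≥ 0`, and at `t_1 - h` if `t_1 < 0`. -/
def bigRect (t : ℕ → ℝ) (p : ℕ) (d : ℝ) (K : ℕ) (h : ℝ) : Set ℂ :=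
  {z | min 0 (t 1) - h ≤ z.re ∧ z.re ≤ clusterPt t p d (K + 1) + d / (2 * p) ∧ |z.im| ≤ h}

/-- The set `Π_0 ∪ ⋃_{j > K} Π_j`. -/
def spectralRegion (t : ℕ → ℝ) (p : ℕ) (d : ℝ) (K : ℕ) (h : ℝ) : Set ℂ :=
  bigRect t p d K h ∪ ⋃ j > K, clusterRect t p d j

/-! ### The perturbation -/

/-- `β_k = ‖B φ_k‖²`. -/
def betaSeq (B : H →ₗ.[ℂ] H) (φ : ℕ+ → H) (hφ : ∀ k, φ k ∈ B.domain) (k : ℕ+) : ℝ :=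
  ‖B ⟨φ k, hφ k⟩‖ ^ 2

/-- The bound `(d/2p)² · 1 / (8p(1 + π²/3))`. -/
def betaBound (p : ℕ) (d : ℝ) : ℝ :=
  (d / (2 * p)) ^ 2 * (1 / (8 * p * (1 + Real.pi ^ 2 / 3)))

/-- The conditions on `M`, `N` and `h`:
* `β_k` is at most the bound for all `k ≥ M`;
* `‖β‖_∞ ≤ (d²/16p²) (2p ∑_{j ≥ N+1} 1/j²)⁻¹`;
* `h > 0` and `∑_{j ≥ 0} 1/(h² + (jd/2p)²) ≤ 1/(8p‖β‖_∞)`, written without the division by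
  `‖β‖_∞`, so that every `h > 0` is allowed if `β = 0`. -/
def Admissible (β : ℕ+ → ℝ) (p : ℕ) (d : ℝ) (M N : ℕ) (h : ℝ) : Prop :=
  (∀ k : ℕ+, M ≤ (k : ℕ) → β k ≤ betaBound p d) ∧
  (⨆ k, β k) ≤ d ^ 2 / (16 * (p : ℝ) ^ 2) * (2 * (p : ℝ) * ∑' i : ℕ, 1 / ((N + 1 + i : ℕ) : ℝ) ^ 2)⁻¹ ∧
  0 < h ∧
  (8 * (p : ℝ) * ⨆ k, β k) * ∑' j : ℕ, 1 / (h ^ 2 + (j * d / (2 * p)) ^ 2) ≤ 1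

end SpectralPerturbation

end

noncomputable section

namespace SpectralPerturbation

/-! ### Sums over separated sequences -/

/-! Everything rests on the bound `‖B R⁰(z)‖² ≤ ∑ β_k / |z - t_k|²`. It follows from Cauchy–Schwarz
and Bessel because `R⁰(z)` is diagonal, and closedness of `B` lets it pass under the sum
(`IsResolventAt.norm_closed_comp_le`). Off the region the sum is at most `1/4` (`weighted_sum_le`).
To the left of, above and below `Π_0` it suffices to replace `β_k` by its supremum. To the right,
`|Im z| > d/2p`: the terms with `k ≥ M` are small because `β_k` is, and those with `k < M` because
at least `N + 1` cluster gaps separate `t_k` from `Re z`. The counting fact behind both is that at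
most `2p` of the `t_k` have a distance to a given real point in `[md, (m+1)d)` (`separated_sum_le`).

Hence `z - L = (1 - B R⁰(z)) (z - T)` is inverted by a Neumann series, which locates the spectrum.
At one point `z₀` off the region the resolvent `C` of `L` is `R⁰(z₀)` times a bounded operator, so a
norm limit of finite-rank operators.

Discreteness is then the analytic Fredholm theorem for `1 - (z₀ - w) C`, whose inverse yields the
resolvent at `w`. On each ball about `z₀` it reduces to a finite analytic determinant equal to `1`
at `z₀`; its zeros are isolated and give poles of the resolvent (`FiniteRankApprox.exists_pole`). A
pole of finite order confines the range of the Riesz projection to the kernel of a power of the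
pencil, which is finite-dimensional (`hasDiscreteSpectrum_of_finiteRankApprox`). -/

theorem summable_inv_sq_add_sq_mul (c : ℝ) {d : ℝ} (hd : 0 < d) :
    Summable fun m : ℕ => 1 / (c ^ 2 + (m * d) ^ 2) := by
  have h : Summable fun m : ℕ => 1 / d ^ 2 * (1 / (m : ℝ) ^ 2) :=
    (Real.summable_one_div_nat_pow.mpr one_lt_two).mul_left _
  refine h.of_norm_bounded_eventually_nat ?_
  filter_upwards [eventually_ge_atTop 1] with m hm
  have hm' : (0 : ℝ) < m := by exact_mod_cast hm
  rw [Real.norm_of_nonneg (by positivity), one_div_mul_one_div]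
  apply one_div_le_one_div_of_le (by positivity)
  nlinarith [sq_nonneg c]

theorem strictMono_of_step {t : ℕ → ℝ} (hmono : ∀ k : ℕ, 1 ≤ k → t k < t (k + 1)) {k l : ℕ}
    (hk : 1 ≤ k) (hkl : k < l) : t k < t l := by
  induction l, hkl using Nat.le_induction with
  | base => exact hmono k hk
  | succ n hn ih => exact ih.trans (hmono n (by omega))

theorem mono_of_step {t : ℕ → ℝ} (hmono : ∀ k : ℕ, 1 ≤ k → t k < t (k + 1)) {k l : ℕ}
    (hk : 1 ≤ k) (hkl : k ≤ l) : t k ≤ t l := by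
  rcases hkl.eq_or_lt with rfl | h
  · exact le_rfl
  · exact (strictMono_of_step hmono hk h).le

/-- Two terms whose indices are congruent modulo `p` are more than `d` apart. -/
theorem gap_of_mod_eq {t : ℕ → ℝ} (hmono : ∀ k : ℕ, 1 ≤ k → t k < t (k + 1)) {p : ℕ} {d : ℝ}
    (hgap : ∀ k : ℕ, 1 ≤ k → d < t (k + p) - t k) {k l : ℕ} (hk : 1 ≤ k) (hkl : k < l)
    (hmod : k % p = l % p) : d < t l - t k := by
  have h1 : k + p ≤ l := by
    have h2 : p ∣ l - k := (Nat.modEq_iff_dvd' hkl.le).mp hmod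
    have := Nat.le_of_dvd (by omega) h2
    omega
  linarith [hgap k hk, mono_of_step hmono (by omega) h1]

/-- The side of `a`, the residue modulo `p` and the number of the cell of length `d` determine an
index of a sequence with at most `p` terms in every such cell. -/
theorem cell_injective {t : ℕ → ℝ} (hmono : ∀ k : ℕ, 1 ≤ k → t k < t (k + 1)) {p : ℕ}
    (hp : 1 ≤ p) {d : ℝ} (hd : 0 < d) (hgap : ∀ k : ℕ, 1 ≤ k → d < t (k + p) - t k) (a : ℝ) :
    Function.Injective fun k : ℕ+ =>
      ((decide (a ≤ t k), ⟨(k : ℕ) % p, Nat.mod_lt _ hp⟩, ⌊|t k - a| / d⌋₊) :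
        Bool × Fin p × ℕ) := by
  have key : ∀ k l : ℕ+, k < l → decide (a ≤ t k) = decide (a ≤ t l) → (k : ℕ) % p = (l : ℕ) % p →
      ⌊|t k - a| / d⌋₊ ≠ ⌊|t l - a| / d⌋₊ := by
    intro k l hkl hs hm
    have hg : d < t l - t k := gap_of_mod_eq hmono hgap k.pos hkl hm
    have floor_lt : ∀ x y : ℝ, 0 ≤ x → x + d < y → ⌊x / d⌋₊ < ⌊y / d⌋₊ := by
      intro x y hx hxy
      rw [← Nat.succ_le_iff, Nat.le_floor_iff (by apply div_nonneg <;> linarith)]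
      push_cast
      have h1 := Nat.floor_le (div_nonneg hx hd.le)
      have h2 : x / d + 1 ≤ y / d := by
        rw [← sub_nonneg]
        have : y / d - (x / d + 1) = (y - (x + d)) / d := by field_simp
        rw [this]
        apply div_nonneg <;> linarith
      linarith
    by_cases h : a ≤ t k
    · have h' : a ≤ t l := by linarith
      rw [abs_of_nonneg (by linarith), abs_of_nonneg (by linarith)]
      exact (floor_lt _ _ (by linarith) (by linarith)).ne
    · have h' : ¬ a ≤ t l := by simpa [h] using hs
      push Not at h h'
      rw [abs_of_neg (by linarith), abs_of_neg (by linarith)]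
      exact (floor_lt _ _ (by linarith) (by linarith)).ne'
  intro k l h
  simp only [Prod.mk.injEq, Fin.mk.injEq] at h
  rcases lt_trichotomy k l with hkl | hkl | hkl
  · exact absurd h.2.2 (key k l hkl h.1 h.2.1)
  · exact hkl
  · exact absurd h.2.2.symm (key l k hkl h.1.symm h.2.1.symm)

/-- By `cell_injective` the indices embed into `2p` copies of the cells `m = 0, 1, …`, and a term in
cell `m` has `|t k - a| ≥ m d`. -/
theorem separated_sum_le {t : ℕ → ℝ} (hmono : ∀ k : ℕ, 1 ≤ k → t k < t (k + 1)) {p : ℕ}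
    (hp : 1 ≤ p) {d : ℝ} (hd : 0 < d) (hgap : ∀ k : ℕ, 1 ≤ k → d < t (k + p) - t k) (a : ℝ)
    {c : ℝ} (hc : 0 < c) :
    Summable (fun k : ℕ+ => 1 / (c ^ 2 + (t k - a) ^ 2)) ∧
      ∑' k : ℕ+, 1 / (c ^ 2 + (t k - a) ^ 2) ≤
        2 * (p : ℝ) * ∑' m : ℕ, 1 / (c ^ 2 + (m * d) ^ 2) := by
  set g : ℕ → ℝ := fun m => 1 / (c ^ 2 + (m * d) ^ 2) with hg
  have hgs : Summable g := summable_inv_sq_add_sq_mul c hd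
  have hG : HasSum (fun x : Bool × Fin p × ℕ => g x.2.2) (2 * (p : ℝ) * ∑' m, g m) := by
    have h1 : Summable fun x : Fin p × ℕ => g x.2 := by
      have := (summable_of_hasFiniteSupport (f := fun _ : Fin p => (1 : ℝ))
        (Set.toFinite _)).mul_of_nonneg hgs (fun _ => zero_le_one) (fun m => by positivity)
      simpa using this
    have h2 : Summable fun x : Bool × Fin p × ℕ => g x.2.2 := by
      have := (summable_of_hasFiniteSupport (f := fun _ : Bool => (1 : ℝ))
        (Set.toFinite _)).mul_of_nonneg h1 (fun _ => zero_le_one) (fun m => by positivity)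
      simpa using this
    have h3 : ∑' x : Bool × Fin p × ℕ, g x.2.2 = 2 * (p : ℝ) * ∑' m, g m := by
      rw [h2.tsum_prod, tsum_fintype]
      simp only [h1.tsum_prod, tsum_fintype]
      simp
      ring
    rw [← h3]
    exact h2.hasSum
  have hle : ∀ k : ℕ+, 1 / (c ^ 2 + (t k - a) ^ 2) ≤ g ⌊|t k - a| / d⌋₊ := by
    intro k
    apply one_div_le_one_div_of_le (by positivity)
    have h1 := Nat.floor_le (div_nonneg (abs_nonneg (t k - a)) hd.le)
    rw [le_div_iff₀ hd] at h1
    have h2 := pow_le_pow_left₀ (by positivity) h1 2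
    rw [sq_abs] at h2
    linarith
  have hinj := cell_injective hmono hp hd hgap a
  have hs : Summable (fun k : ℕ+ => 1 / (c ^ 2 + (t k - a) ^ 2)) :=
    (hG.summable.comp_injective hinj).of_nonneg_of_le (fun k => by positivity) hle
  refine ⟨hs, ?_⟩
  rw [← hG.tsum_eq]
  exact hs.tsum_le_tsum_of_inj _ hinj (fun x _ => by positivity) hle hG.summable

/-! ### Clusters -/

/-- If `p` consecutive gaps were all below `d/p`, they would add up to at most `d`. So the set
defining `gam` is nonempty and its infimum is attained, not the default `0`. -/
theorem gap_at_gam {t : ℕ → ℝ} {p : ℕ} (hp : 1 ≤ p) {d : ℝ}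
    (hgap : ∀ k : ℕ, 1 ≤ k → d < t (k + p) - t k) {k : ℕ} (hk : 1 ≤ k) :
    d / p ≤ t (k + gam t p d k + 1) - t (k + gam t p d k) := by
  have hp' : (0 : ℝ) < p := by exact_mod_cast hp
  have hne : {j : ℕ | d / p ≤ t (k + j + 1) - t (k + j)}.Nonempty := by
    by_contra hemp
    rw [Set.not_nonempty_iff_eq_empty, Set.eq_empty_iff_forall_notMem] at hemp
    simp only [Set.mem_ofPred_eq, not_le] at hemp
    have h1 : t (k + p) - t k = ∑ j ∈ Finset.range p, (t (k + j + 1) - t (k + j)) :=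
      (Finset.sum_range_sub (fun j => t (k + j)) p).symm
    have h2 : ∑ j ∈ Finset.range p, (t (k + j + 1) - t (k + j)) ≤
        ∑ _j ∈ Finset.range p, d / p := Finset.sum_le_sum fun j _ => (hemp j).le
    rw [Finset.sum_const, Finset.card_range, nsmul_eq_mul, mul_div_cancel₀ _ hp'.ne'] at h2
    linarith [hgap k hk]
  exact Nat.sInf_mem hne

theorem clusterIdx_ge (t : ℕ → ℝ) (p : ℕ) (d : ℝ) (k : ℕ) (hk : 1 ≤ k) :
    k ≤ clusterIdx t p d (k + 1) := by
  induction k, hk using Nat.le_induction with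
  | base => simp [clusterIdx]
  | succ n hn ih =>
    obtain ⟨m, rfl⟩ : ∃ m, n = m + 1 := ⟨n - 1, by omega⟩
    change m + 1 ≤ clusterIdx t p d (m + 2) at ih
    change m + 2 ≤ clusterIdx t p d (m + 2) + 1 + gam t p d (clusterIdx t p d (m + 2) + 1)
    omega

/-- From index `2` on, the points `T_k` are ends of clusters, so the gap closing one cluster
separates consecutive points. This fails for `T_1`, the start of the first cluster, which may equal
`T_2`. -/
theorem clusterPt_step {t : ℕ → ℝ} (hmono : ∀ k : ℕ, 1 ≤ k → t k < t (k + 1)) {p : ℕ} (hp : 1 ≤ p)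
    {d : ℝ} (hgap : ∀ k : ℕ, 1 ≤ k → d < t (k + p) - t k) {k : ℕ} (hk : 1 ≤ k) :
    clusterPt t p d (k + 1) + d / p ≤ clusterPt t p d (k + 2) := by
  have h1 : d / p ≤ t (clusterIdx t p d (k + 1) + 1) - t (clusterIdx t p d (k + 1)) := by
    obtain ⟨m, rfl⟩ : ∃ m, k = m + 1 := ⟨k - 1, by omega⟩
    rcases m with _ | m
    · simpa [clusterIdx] using gap_at_gam hp hgap le_rfl
    · simpa [clusterIdx] using gap_at_gam hp hgap (k := clusterIdx t p d (m + 2) + 1) (by omega)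
  have h2 : t (clusterIdx t p d (k + 1) + 1) ≤ clusterPt t p d (k + 2) := by
    apply mono_of_step hmono (by omega)
    obtain ⟨m, rfl⟩ : ∃ m, k = m + 1 := ⟨k - 1, by omega⟩
    exact Nat.le_add_right _ _
  rw [clusterPt]
  linarith

theorem clusterPt_sub_ge {t : ℕ → ℝ} (hmono : ∀ k : ℕ, 1 ≤ k → t k < t (k + 1)) {p : ℕ}
    (hp : 1 ≤ p) {d : ℝ} (hgap : ∀ k : ℕ, 1 ≤ k → d < t (k + p) - t k) {k : ℕ} (hk : 1 ≤ k)
    (m : ℕ) : t k + m * (d / p) ≤ clusterPt t p d (k + m + 1) := by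
  induction m with
  | zero => simpa [clusterPt] using mono_of_step hmono hk (clusterIdx_ge t p d k hk)
  | succ m ih =>
    have := clusterPt_step hmono hp hgap (k := k + m) (by omega)
    rw [show k + (m + 1) + 1 = k + m + 2 by ring]
    push_cast
    linarith

/-- The rectangles with number above `K` cover a half-strip. -/
theorem exists_clusterRect {t : ℕ → ℝ} (hmono : ∀ k : ℕ, 1 ≤ k → t k < t (k + 1)) {p : ℕ}
    (hp : 1 ≤ p) {d : ℝ} (hd : 0 < d) (hgap : ∀ k : ℕ, 1 ≤ k → d < t (k + p) - t k) {K : ℕ}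
    {z : ℂ} (hre : clusterPt t p d (K + 1) + d / (2 * p) < z.re) (him : |z.im| ≤ d / (2 * p)) :
    ∃ j > K, z ∈ clusterRect t p d j := by
  have hp' : (0 : ℝ) < p := by exact_mod_cast hp
  have hδ : 0 < d / (2 * p) := by positivity
  have hex : ∃ m, z.re ≤ clusterPt t p d (K + m + 1) + d / (2 * p) := by
    obtain ⟨m, hm⟩ := exists_nat_ge ((z.re - t (K + 1)) / (d / p))
    refine ⟨m + 1, ?_⟩
    rw [div_le_iff₀ (by positivity)] at hm
    have := clusterPt_sub_ge hmono hp hgap (k := K + 1) (by omega) m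
    rw [show K + (m + 1) + 1 = K + 1 + m + 1 by ring]
    linarith
  classical
  obtain ⟨hm, hmin⟩ := (⟨Nat.find_spec hex, fun n => Nat.find_min hex (m := n)⟩ :
    z.re ≤ clusterPt t p d (K + Nat.find hex + 1) + d / (2 * p) ∧ ∀ n < Nat.find hex, _)
  generalize Nat.find hex = m at hm hmin
  rcases m with _ | m
  · exact absurd hm (by simpa using hre)
  have hlow := hmin m (by omega)
  push Not at hlow
  refine ⟨K + m + 1, by omega, ?_, him⟩
  rw [clusterInterval]
  -- `F_1` is the exception: it starts at `T_1 - d/2p`, to the left of the bound on `z.re`.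
  split_ifs with h1
  · obtain ⟨rfl, rfl⟩ : K = 0 ∧ m = 0 := by omega
    simp only [zero_add] at hm hlow
    exact ⟨by linarith, hm⟩
  · exact ⟨hlow.le, hm⟩

/-! ### Admissible parameters -/

theorem tail_pos (N : ℕ) : 0 < ∑' i : ℕ, 1 / ((N + 1 + i : ℕ) : ℝ) ^ 2 := by
  have hs : Summable fun i : ℕ => 1 / ((N + 1 + i : ℕ) : ℝ) ^ 2 :=
    (Real.summable_one_div_nat_pow.mpr one_lt_two).comp_injective (add_right_injective (N + 1))
  exact hs.tsum_pos (fun i => by positivity) 0 (by positivity)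

/-- The tail of `∑ 1/j²` tends to `0` as `N` grows, and so does the sum in the last condition as `h`
grows, by domination with its value at `h = 1`. -/
theorem exists_admissible {β : ℕ+ → ℝ} (hβ : ∀ k, 0 ≤ β k) {p : ℕ} (hp : 1 ≤ p) {d : ℝ}
    (hd : 0 < d) (hev : ∀ᶠ k in atTop, β k ≤ betaBound p d) :
    ∃ (M N : ℕ) (h : ℝ), Admissible β p d M N h := by
  have hp' : (0 : ℝ) < p := by exact_mod_cast hp
  obtain ⟨M, hM⟩ := eventually_atTop.mp hev
  have hsup : 0 ≤ ⨆ k, β k := Real.iSup_nonneg hβ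
  set b := ⨆ k, β k
  have hN : Tendsto (fun N : ℕ => b * (2 * p * ∑' i : ℕ, 1 / ((N + 1 + i : ℕ) : ℝ) ^ 2)) atTop
      (𝓝 (b * (2 * p * 0))) := by
    refine Tendsto.const_mul _ (Tendsto.const_mul _ ?_)
    have := (tendsto_sum_nat_add fun n : ℕ => 1 / (n : ℝ) ^ 2).comp (tendsto_add_atTop_nat 1)
    refine this.congr fun N => tsum_congr fun i => ?_
    simp only [add_comm]
  obtain ⟨N, hN⟩ := (hN.eventually_lt_const
    (show b * (2 * p * 0) < d ^ 2 / (16 * (p : ℝ) ^ 2) by simp; positivity)).exists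
  have hh : Tendsto (fun h : ℝ => (8 * p * b) * ∑' j : ℕ, 1 / (h ^ 2 + (j * d / (2 * p)) ^ 2)) atTop
      (𝓝 ((8 * p * b) * ∑' _j : ℕ, 0)) := by
    refine Tendsto.const_mul _ ?_
    refine tendsto_tsum_of_dominated_convergence (bound := fun j : ℕ =>
      1 / ((1 : ℝ) ^ 2 + (j * (d / (2 * p))) ^ 2))
      (summable_inv_sq_add_sq_mul 1 (by positivity)) (fun j => ?_) ?_
    · simp only [one_div]
      refine tendsto_inv_atTop_zero.comp ?_
      exact tendsto_atTop_add_const_right _ _ (tendsto_pow_atTop two_ne_zero)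
    · filter_upwards [eventually_ge_atTop 1] with h hh j
      rw [Real.norm_of_nonneg (by positivity), mul_div_assoc]
      apply one_div_le_one_div_of_le (by positivity)
      gcongr
  obtain ⟨h, h1, h2⟩ := ((hh.eventually_lt_const (show _ < (1 : ℝ) by simp)).and
    (eventually_gt_atTop 0)).exists
  refine ⟨M, N, h, fun k hk => hM k hk, ?_, h2, h1.le⟩
  rw [← div_eq_mul_inv, le_div_iff₀ (mul_pos (by positivity) (tail_pos N))]
  exact hN.le

/-- Away from the region, `∑ β_k / |z - t_k|² ≤ 1/4`. -/
theorem weighted_sum_le {t : ℕ → ℝ} (hmono : ∀ k : ℕ, 1 ≤ k → t k < t (k + 1)) {p : ℕ}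
    (hp : 1 ≤ p) {d : ℝ} (hd : 0 < d) (hgap : ∀ k : ℕ, 1 ≤ k → d < t (k + p) - t k)
    {β : ℕ+ → ℝ} (hβ : ∀ k, 0 ≤ β k) (hbdd : BddAbove (Set.range β)) {M N : ℕ} {h : ℝ}
    (hadm : Admissible β p d M N h) {z : ℂ} (hz : z ∉ spectralRegion t p d (M + N) h) :
    (∀ k : ℕ+, z ≠ t k) ∧ Summable (fun k : ℕ+ => β k / ‖z - t k‖ ^ 2) ∧
      ∑' k : ℕ+, β k / ‖z - t k‖ ^ 2 ≤ 1 / 4 := by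
  obtain ⟨hM, hN, hh, hsum⟩ := hadm
  have hp' : (0 : ℝ) < p := by exact_mod_cast hp
  have hp1 : (1 : ℝ) ≤ p := by exact_mod_cast hp
  have hb0 : 0 ≤ ⨆ k, β k := Real.iSup_nonneg hβ
  have hb : ∀ k, β k ≤ ⨆ k, β k := le_ciSup hbdd
  set b := ⨆ k, β k
  have hnorm : ∀ k : ℕ+, ‖z - t k‖ ^ 2 = z.im ^ 2 + (t k - z.re) ^ 2 := by
    intro k
    rw [← Complex.normSq_eq_norm_sq, Complex.normSq_apply]
    simp
    ring
  -- A uniform bound suffices left of the clusters.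
  have crude : ∀ a : ℝ, (∀ k : ℕ+, h ^ 2 + (t k - a) ^ 2 ≤ ‖z - t k‖ ^ 2) →
      (∀ k : ℕ+, z ≠ t k) ∧ Summable (fun k : ℕ+ => β k / ‖z - t k‖ ^ 2) ∧
      ∑' k : ℕ+, β k / ‖z - t k‖ ^ 2 ≤ 1 / 4 := by
    intro a ha
    obtain ⟨hs, hle⟩ := separated_sum_le hmono hp hd hgap a hh
    have hterm : ∀ k : ℕ+, β k / ‖z - t k‖ ^ 2 ≤ b * (1 / (h ^ 2 + (t k - a) ^ 2)) := by
      intro k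
      rw [mul_one_div]
      exact div_le_div₀ hb0 (hb k) (by positivity) (ha k)
    have hs' := (hs.mul_left b).of_nonneg_of_le (fun k => div_nonneg (hβ k) (sq_nonneg _)) hterm
    refine ⟨fun k hk => ?_, hs', ?_⟩
    · have h1 := ha k
      rw [hk, sub_self, norm_zero] at h1
      have h2 : 0 < h ^ 2 := by positivity
      nlinarith [sq_nonneg (t k - a)]
    -- Cells of length `d` are longer than the step `d/2p` in the condition on `h`, so the latter is
    -- more than enough.
    have h1 : ∑' m : ℕ, 1 / (h ^ 2 + (m * d) ^ 2) ≤
        ∑' j : ℕ, 1 / (h ^ 2 + (j * d / (2 * p)) ^ 2) := by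
      refine (summable_inv_sq_add_sq_mul h hd).tsum_le_tsum (fun m => ?_) ?_
      · apply one_div_le_one_div_of_le (by positivity)
        gcongr
        exact div_le_self (by positivity) (by linarith)
      · simpa only [mul_div_assoc] using
          summable_inv_sq_add_sq_mul h (show 0 < d / (2 * p) by positivity)
    calc ∑' k : ℕ+, β k / ‖z - t k‖ ^ 2
        ≤ b * ∑' k : ℕ+, 1 / (h ^ 2 + (t k - a) ^ 2) := by
          rw [← tsum_mul_left]
          exact hs'.tsum_le_tsum hterm (hs.mul_left b)
      _ ≤ b * (2 * p * ∑' j : ℕ, 1 / (h ^ 2 + (j * d / (2 * p)) ^ 2)) := by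
          refine mul_le_mul_of_nonneg_left (hle.trans ?_) hb0
          exact mul_le_mul_of_nonneg_left h1 (by positivity)
      _ ≤ 1 / 4 := by linarith
  simp only [spectralRegion, Set.mem_union, Set.mem_iUnion, not_or, not_exists] at hz
  obtain ⟨hz0, hz1⟩ := hz
  rcases lt_or_ge (clusterPt t p d (M + N + 1) + d / (2 * p)) z.re with hre | hre
  swap
  · rcases lt_or_ge z.re (min 0 (t 1) - h) with hl | hl
    -- Left of `Π_0` all `t k` exceed `z.re + h`, and `(h + x)² ≥ h² + x²` for `x ≥ 0`.
    · refine crude (z.re + h) fun k => ?_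
      rw [hnorm]
      have h1 := mono_of_step hmono le_rfl k.pos
      have h2 := min_le_right 0 (t 1)
      nlinarith [sq_nonneg z.im, mul_pos hh (show 0 < t k - z.re - h by linarith)]
    · refine crude z.re fun k => ?_
      have h1 : h < |z.im| := by
        by_contra hcon
        exact hz0 ⟨hl, hre, not_lt.mp hcon⟩
      rw [hnorm]
      have := pow_le_pow_left₀ hh.le h1.le 2
      rw [sq_abs] at this
      linarith
  -- Right of the first `M + N` clusters.
  set δ := d / (2 * p) with hδdef
  have hδ : 0 < δ := by positivity
  have hdδ : d / p = 2 * δ := by rw [hδdef]; field_simp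
  have hdδ' : d = 2 * p * δ := by rw [hδdef]; field_simp
  have him : δ < |z.im| := by
    by_contra hcon
    obtain ⟨j, hj, hzj⟩ := exists_clusterRect hmono hp hd hgap hre (not_lt.mp hcon)
    exact hz1 j hj hzj
  have him2 : δ ^ 2 < z.im ^ 2 := by
    have := pow_lt_pow_left₀ him hδ.le two_ne_zero
    rwa [sq_abs] at this
  have hpos : ∀ k : ℕ+, 0 < ‖z - t k‖ ^ 2 := fun k => by
    rw [hnorm]; nlinarith [sq_nonneg (t k - z.re), sq_nonneg δ]
  obtain ⟨hs, hle⟩ := separated_sum_le hmono hp hd hgap z.re hδ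
  set S := ∑' i : ℕ, 1 / ((N + 1 + i : ℕ) : ℝ) ^ 2 with hS
  have hSpos : 0 < S := tail_pos N
  have hqs : Summable fun i : ℕ => 1 / ((N + 1 + i : ℕ) : ℝ) ^ 2 :=
    (Real.summable_one_div_nat_pow.mpr one_lt_two).comp_injective (add_right_injective (N + 1))
  -- The terms with a small index.
  set w : ℕ+ → ℝ := fun k => if (k : ℕ) < M then 1 / (((M + N - k : ℕ) : ℝ)) ^ 2 else 0 with hw
  have hwfin : Set.Finite (Function.support w) := by
    have : Function.support w ⊆ (fun k : ℕ+ => (k : ℕ)) ⁻¹' Set.Iio M := by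
      intro k hk
      by_contra hcon
      exact hk (if_neg hcon)
    exact ((Set.finite_Iio M).preimage PNat.coe_injective.injOn).subset this
  have hws : Summable w := summable_of_hasFiniteSupport hwfin
  have hwle : ∑' k, w k ≤ S := by
    have hsupp : ∑' k, w k = ∑' k : Function.support w, w k := (tsum_subtype_support w).symm
    rw [hsupp]
    have hlt : ∀ k : Function.support w, ((k : ℕ+) : ℕ) < M := fun k => by
      by_contra hcon
      exact k.2 (if_neg hcon)
    -- For `k < M`, `M + N - k = N + 1 + (M - 1 - k)`: the distances, counted in cluster gaps, are
    -- distinct integers above `N`.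
    refine Summable.tsum_le_tsum_of_inj (fun k : Function.support w => M - 1 - ((k : ℕ+) : ℕ))
      ?_ (fun i _ => by positivity) (fun k => ?_) (hws.subtype _) hqs
    · intro k l hkl
      have h1 := hlt k
      have h2 := hlt l
      simp only at hkl
      exact Subtype.ext (PNat.coe_injective (by omega))
    · have h1 := hlt k
      refine (if_pos h1).le.trans ?_
      rw [show M + N - ((k : ℕ+) : ℕ) = N + 1 + (M - 1 - ((k : ℕ+) : ℕ)) by omega]
  have hterm : ∀ k : ℕ+, β k / ‖z - t k‖ ^ 2 ≤
      betaBound p d * (1 / (δ ^ 2 + (t k - z.re) ^ 2)) + b / (4 * δ ^ 2) * w k := by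
    intro k
    have hbb : 0 ≤ betaBound p d := by unfold betaBound; positivity
    rcases lt_or_ge (k : ℕ) M with hk | hk
    -- `M + N - k` cluster gaps, each at least `2δ`, lie between `t k` and `T_{M+N+1} < z.re`.
    · have h1 := clusterPt_sub_ge hmono hp hgap (k := k) k.pos (M + N - k)
      rw [show (k : ℕ) + (M + N - k) + 1 = M + N + 1 by omega, hdδ] at h1
      have hn : (0 : ℝ) < ((M + N - k : ℕ) : ℝ) := by
        have : 0 < M + N - (k : ℕ) := by omega
        exact_mod_cast this
      have h2 : 4 * δ ^ 2 * ((M + N - k : ℕ) : ℝ) ^ 2 ≤ ‖z - t k‖ ^ 2 := by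
        rw [hnorm]
        have h3 : ((M + N - k : ℕ) : ℝ) * (2 * δ) ≤ z.re - t k := by linarith
        have := pow_le_pow_left₀ (by positivity) h3 2
        nlinarith [sq_nonneg z.im]
      have h4 : β k / ‖z - t k‖ ^ 2 ≤ b / (4 * δ ^ 2 * ((M + N - k : ℕ) : ℝ) ^ 2) :=
        div_le_div₀ hb0 (hb k) (by positivity) h2
      have h5 : b / (4 * δ ^ 2) * w k = b / (4 * δ ^ 2 * ((M + N - k : ℕ) : ℝ) ^ 2) := by
        rw [hw]
        simp only [hk, if_true]
        rw [div_mul_div_comm, mul_one]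
      rw [h5]
      have : 0 ≤ betaBound p d * (1 / (δ ^ 2 + (t k - z.re) ^ 2)) := by positivity
      linarith
    · have hwk : w k = 0 := if_neg (not_lt.mpr hk)
      rw [hwk, mul_zero, add_zero, mul_one_div]
      refine div_le_div₀ hbb (hM k hk) (by positivity) ?_
      rw [hnorm]
      linarith
  have hmaj := (hs.mul_left (betaBound p d)).add (hws.mul_left (b / (4 * δ ^ 2)))
  have hs' := hmaj.of_nonneg_of_le (fun k => div_nonneg (hβ k) (sq_nonneg _)) hterm
  refine ⟨fun k hk => ?_, hs', ?_⟩
  · have := hpos k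
    rw [hk] at this
    simp at this
  -- As `d = 2pδ ≥ 2δ`, the term `m ≥ 1` is at most `1/(4δ²m²)`; the term `m = 0` is `1/δ²`.
  have hfirst : ∑' m : ℕ, 1 / (δ ^ 2 + (m * d) ^ 2) ≤ 1 / δ ^ 2 * (1 + Real.pi ^ 2 / 24) := by
    have hz2 : HasSum (fun m : ℕ => 1 / δ ^ 2 * ((if m = 0 then 1 else 0) + 1 / 4 * (1 / (m : ℝ) ^ 2)))
        (1 / δ ^ 2 * (1 + 1 / 4 * (Real.pi ^ 2 / 6))) :=
      ((hasSum_ite_eq 0 (1 : ℝ)).add (hasSum_zeta_two.mul_left _)).mul_left _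
    have hval : 1 / δ ^ 2 * (1 + Real.pi ^ 2 / 24) = 1 / δ ^ 2 * (1 + 1 / 4 * (Real.pi ^ 2 / 6)) := by
      ring
    rw [hval, ← hz2.tsum_eq]
    refine (summable_inv_sq_add_sq_mul δ hd).tsum_le_tsum (fun m => ?_) hz2.summable
    rcases Nat.eq_zero_or_pos m with rfl | hm
    · simp
    · have hm' : (0 : ℝ) < m := by exact_mod_cast hm
      rw [if_neg hm.ne', zero_add, one_div_mul_one_div, one_div_mul_one_div]
      apply one_div_le_one_div_of_le (by positivity)
      rw [hdδ']
      have : (1 : ℝ) ≤ (p : ℝ) ^ 2 := one_le_pow₀ hp1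
      have h3 : δ ^ 2 * (4 * (m : ℝ) ^ 2) * 1 ≤ δ ^ 2 * (4 * (m : ℝ) ^ 2) * (p : ℝ) ^ 2 := by
        gcongr
      nlinarith [sq_nonneg δ]
  -- The budget `1/4` is split into `3/16` for the small `β_k` and `1/16` for the indices below `M`.
  have hA : betaBound p d * (2 * p * (1 / δ ^ 2 * (1 + Real.pi ^ 2 / 24))) ≤ 3 / 16 := by
    have : betaBound p d * (2 * p * (1 / δ ^ 2 * (1 + Real.pi ^ 2 / 24))) =
        (1 + Real.pi ^ 2 / 24) / (4 * (1 + Real.pi ^ 2 / 3)) := by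
      rw [betaBound, ← hδdef]
      field_simp
      ring
    rw [this, div_le_iff₀ (by positivity)]
    nlinarith [Real.pi_gt_three]
  have hB : b / (4 * δ ^ 2) * S ≤ 1 / 16 := by
    rw [← div_eq_mul_inv, le_div_iff₀ (by positivity)] at hN
    have h1 : d ^ 2 / (16 * (p : ℝ) ^ 2) = δ ^ 2 / 4 := by rw [hδdef]; field_simp; norm_num
    rw [h1] at hN
    rw [div_mul_eq_mul_div, div_le_iff₀ (by positivity)]
    have h2 : b * S * 1 ≤ b * S * p := by gcongr
    nlinarith
  calc ∑' k : ℕ+, β k / ‖z - t k‖ ^ 2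
      ≤ betaBound p d * ∑' k : ℕ+, 1 / (δ ^ 2 + (t k - z.re) ^ 2) + b / (4 * δ ^ 2) * ∑' k, w k := by
        rw [← tsum_mul_left, ← tsum_mul_left,
          ← (hs.mul_left (betaBound p d)).tsum_add (hws.mul_left (b / (4 * δ ^ 2)))]
        exact hs'.tsum_le_tsum hterm hmaj
    _ ≤ betaBound p d * (2 * p * (1 / δ ^ 2 * (1 + Real.pi ^ 2 / 24))) + b / (4 * δ ^ 2) * S := by
        have hbb : 0 ≤ betaBound p d := by unfold betaBound; positivity
        gcongr
        exact hle.trans (by gcongr)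
    _ ≤ 1 / 4 := by linarith

/-! ### Finite-rank perturbations of the identity -/

section FiniteRank

variable {H : Type*} [NormedAddCommGroup H] [NormedSpace ℂ H] {m : ℕ}

/-- The matrix of `1 - K J` for `J : ℂᵐ → H` and `K : H → ℂᵐ`. -/
def pencilMatrix (J : (Fin m → ℂ) →L[ℂ] H) (K : H →L[ℂ] (Fin m → ℂ)) : Matrix (Fin m) (Fin m) ℂ :=
  LinearMap.toMatrix' (LinearMap.id - (K ∘L J).toLinearMap)

theorem pencilMatrix_mulVec (J : (Fin m → ℂ) →L[ℂ] H) (K : H →L[ℂ] (Fin m → ℂ)) (e : Fin m → ℂ) :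
    (pencilMatrix J K).mulVec e = e - K (J e) := by
  rw [pencilMatrix, LinearMap.toMatrix'_mulVec]
  rfl

theorem pencilMatrix_apply (J : (Fin m → ℂ) →L[ℂ] H) (K : H →L[ℂ] (Fin m → ℂ)) (i j : Fin m) :
    pencilMatrix J K i j = (Pi.single j 1 : Fin m → ℂ) i - K (J (Pi.single j 1)) i := by
  simp [pencilMatrix, LinearMap.toMatrix'_apply]

/-- A matrix as a continuous operator on `ℂᵐ`, as a linear map of the matrix. -/
def matrixOp (m : ℕ) : Matrix (Fin m) (Fin m) ℂ →ₗ[ℂ] ((Fin m → ℂ) →L[ℂ] (Fin m → ℂ)) :=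
  (LinearMap.toContinuousLinearMap (𝕜 := ℂ) (E := Fin m → ℂ) (F' := Fin m → ℂ)).toLinearMap ∘ₗ
    (Matrix.toLin' (R := ℂ) (m := Fin m) (n := Fin m)).toLinearMap

theorem matrixOp_apply (A : Matrix (Fin m) (Fin m) ℂ) (e : Fin m → ℂ) :
    matrixOp m A e = A.mulVec e := by
  simp [matrixOp]

theorem continuous_matrixOp : Continuous (matrixOp m) :=
  LinearMap.continuous_of_finiteDimensional _

/-- The inverse of `1 - J K`, if `1 - K J` is invertible. -/
theorem finiteRank_inverse (J : (Fin m → ℂ) →L[ℂ] H) (K : H →L[ℂ] (Fin m → ℂ))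
    (hdet : (pencilMatrix J K).det ≠ 0) :
    (1 - J ∘L K) * (1 + (pencilMatrix J K).det⁻¹ •
        (J ∘L matrixOp m (pencilMatrix J K).adjugate ∘L K)) = 1 ∧
      (1 + (pencilMatrix J K).det⁻¹ •
        (J ∘L matrixOp m (pencilMatrix J K).adjugate ∘L K)) * (1 - J ∘L K) = 1 := by
  set A := pencilMatrix J K with hA
  -- The inverse is `1 + J (1 - K J)⁻¹ K`, with the inverse matrix written as adjugate over
  -- determinant to expose the pole.
  have h1 : ∀ e, A.adjugate.mulVec e - K (J (A.adjugate.mulVec e)) = A.det • e := by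
    intro e
    rw [← pencilMatrix_mulVec, Matrix.mulVec_mulVec, ← hA, Matrix.mul_adjugate, Matrix.smul_mulVec,
      Matrix.one_mulVec]
  have h2 : ∀ e, A.adjugate.mulVec (e - K (J e)) = A.det • e := by
    intro e
    rw [← pencilMatrix_mulVec, Matrix.mulVec_mulVec, ← hA, Matrix.adjugate_mul, Matrix.smul_mulVec,
      Matrix.one_mulVec]
  constructor
  · ext f
    have := h1 (K f)
    rw [sub_eq_iff_eq_add] at this
    simp only [mul_apply_eq_comp, add_apply,
      sub_apply, one_apply_eq_self, smul_apply,
      ContinuousLinearMap.comp_apply, matrixOp_apply, map_add, map_smul]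
    have h3 : J (A.adjugate.mulVec (K f)) =
        A.det • J (K f) + J (K (J (A.adjugate.mulVec (K f)))) := by
      rw [← map_smul, ← map_add, ← this]
    set x := J (K (J (A.adjugate.mulVec (K f))))
    rw [h3]
    rw [add_sub_cancel_right, inv_smul_smul₀ hdet]
    abel
  · ext f
    have := h2 (K f)
    simp only [mul_apply_eq_comp, add_apply,
      sub_apply, one_apply_eq_self, smul_apply,
      ContinuousLinearMap.comp_apply, matrixOp_apply, map_sub K, this, map_smul,
      inv_smul_smul₀ hdet]
    abel

theorem exists_fixed_of_det_eq_zero (J : (Fin m → ℂ) →L[ℂ] H) (K : H →L[ℂ] (Fin m → ℂ))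
    (hdet : (pencilMatrix J K).det = 0) : ∃ u : H, u ≠ 0 ∧ J (K u) = u := by
  obtain ⟨e, he, h0⟩ := Matrix.exists_mulVec_eq_zero_iff.mpr hdet
  rw [pencilMatrix_mulVec, sub_eq_zero] at h0
  refine ⟨J e, fun h => he ?_, by rw [← h0]⟩
  rw [h0, h, map_zero]

theorem isUnit_of_two_sided {R : Type*} [Monoid R] {a b : R} (h1 : a * b = 1) (h2 : b * a = 1) :
    IsUnit a := ⟨⟨a, b, h1, h2⟩, rfl⟩

theorem ring_inverse_eq {R : Type*} [MonoidWithZero R] {a b : R} (h1 : a * b = 1) (h2 : b * a = 1) :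
    Ring.inverse a = b := Ring.inverse_unit ⟨a, b, h1, h2⟩

end FiniteRank

/-! ### Pencils `1 - (z₀ - w) C` with `C` a limit of finite-rank operators -/

section Pencil

variable {H : Type*} [NormedAddCommGroup H] [NormedSpace ℂ H]

/-- `C` is a limit in norm of operators of finite rank. -/
def FiniteRankApprox (C : H →L[ℂ] H) : Prop :=
  ∀ ε > 0, ∃ (m : ℕ) (J : (Fin m → ℂ) →L[ℂ] H) (K : H →L[ℂ] (Fin m → ℂ)), ‖C - J ∘L K‖ < ε

/-- `1 - (z₀ - w) C`. -/
def pencil (C : H →L[ℂ] H) (z₀ w : ℂ) : H →L[ℂ] H := 1 - (z₀ - w) • C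

theorem differentiable_pencil (C : H →L[ℂ] H) (z₀ : ℂ) : Differentiable ℂ (pencil C z₀) := by
  unfold pencil
  fun_prop

variable [CompleteSpace H]

theorem isUnit_pencil_of_small {S : H →L[ℂ] H} {z₀ w : ℂ} {ρ : ℝ} (hS : ‖S‖ < 1 / ρ)
    (hw : w ∈ Metric.ball z₀ ρ) : IsUnit (pencil S z₀ w) := by
  have hw' : ‖z₀ - w‖ < ρ := by rwa [Metric.mem_ball, dist_comm, dist_eq_norm] at hw
  have hρ : 0 < ρ := (norm_nonneg _).trans_lt hw'
  apply isUnit_one_sub_of_norm_lt_one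
  rw [norm_smul]
  rw [lt_div_iff₀ hρ] at hS
  nlinarith [norm_nonneg S, norm_nonneg (z₀ - w)]

/-- A finite-rank approximation of `C` for which the pencil of the remainder is invertible on the
ball of radius `ρ` around `z₀`. -/
structure LocalReduction (C : H →L[ℂ] H) (z₀ : ℂ) (ρ : ℝ) where
  (m : ℕ)
  (J : (Fin m → ℂ) →L[ℂ] H)
  (K : H →L[ℂ] (Fin m → ℂ))
  (small : ‖C - J ∘L K‖ < 1 / ρ)

namespace LocalReduction

variable {C : H →L[ℂ] H} {z₀ : ℂ} {ρ : ℝ} (D : LocalReduction C z₀ ρ)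

/-- The inverse of the pencil of the small remainder. -/
def G (w : ℂ) : H →L[ℂ] H := Ring.inverse (pencil (C - D.J ∘L D.K) z₀ w)

/-- The analytic family `(z₀ - w) K G(w)`. -/
def Kw (w : ℂ) : H →L[ℂ] (Fin D.m → ℂ) := (z₀ - w) • (D.K ∘L D.G w)

/-- The determinant of `1 - K(w) J`. -/
def det (w : ℂ) : ℂ := (pencilMatrix D.J (D.Kw w)).det

variable {w : ℂ} (hw : w ∈ Metric.ball z₀ ρ)
include hw

theorem isUnit_small : IsUnit (pencil (C - D.J ∘L D.K) z₀ w) :=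
  isUnit_pencil_of_small D.small hw

theorem small_mul_G : pencil (C - D.J ∘L D.K) z₀ w * D.G w = 1 :=
  Ring.mul_inverse_cancel _ (D.isUnit_small hw)

theorem G_mul_small : D.G w * pencil (C - D.J ∘L D.K) z₀ w = 1 :=
  Ring.inverse_mul_cancel _ (D.isUnit_small hw)

/-- With `S = C - J K`, the pencil of `C` is that of `S` minus `(z₀ - w) J K`; factoring out the
invertible pencil of `S` leaves a finite-rank perturbation of `1`. -/
theorem pencil_eq : pencil C z₀ w = (1 - D.J ∘L D.Kw w) * pencil (C - D.J ∘L D.K) z₀ w := by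
  have h1 : (D.J ∘L D.Kw w) * pencil (C - D.J ∘L D.K) z₀ w = (z₀ - w) • (D.J ∘L D.K) := by
    ext f
    have := DFunLike.congr_fun (D.G_mul_small hw) f
    simp only [mul_apply_eq_comp, one_apply_eq_self] at this
    simp [Kw, this]
  rw [sub_mul, h1, one_mul]
  simp only [pencil]
  module

theorem differentiableAt_G : DifferentiableAt ℂ D.G w :=
  (differentiableAt_inverse (D.isUnit_small hw)).comp w (differentiable_pencil _ _ w)

theorem differentiableAt_Kw : DifferentiableAt ℂ D.Kw w := by
  have h := D.differentiableAt_G hw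
  have h2 : DifferentiableAt ℂ (fun w => D.K ∘L D.G w) w :=
    ((ContinuousLinearMap.compL ℂ H H (Fin D.m → ℂ) D.K).differentiableAt).comp w h
  exact (by fun_prop : DifferentiableAt ℂ (fun w => z₀ - w) w).smul h2

theorem differentiableAt_entry (i j : Fin D.m) :
    DifferentiableAt ℂ (fun w => pencilMatrix D.J (D.Kw w) i j) w := by
  simp only [pencilMatrix_apply]
  have h1 : DifferentiableAt ℂ (fun w => D.Kw w (D.J (Pi.single j 1))) w :=
    (D.differentiableAt_Kw hw).clm_apply (differentiableAt_const _)
  exact (differentiableAt_const _).sub (differentiableAt_pi.mp h1 i)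

theorem differentiableAt_det : DifferentiableAt ℂ D.det w := by
  have : D.det = fun w => ∑ σ : Equiv.Perm (Fin D.m), Equiv.Perm.sign σ •
      ∏ i, pencilMatrix D.J (D.Kw w) (σ i) i := by
    ext w
    exact Matrix.det_apply _
  rw [this]
  refine DifferentiableAt.fun_sum fun σ _ => DifferentiableAt.const_smul ?_ _
  exact DifferentiableAt.fun_finsetProd fun i _ => D.differentiableAt_entry hw _ _

theorem continuousAt_adjugate :
    ContinuousAt (fun w => matrixOp D.m (pencilMatrix D.J (D.Kw w)).adjugate) w := by
  have h1 : ContinuousAt (fun w => pencilMatrix D.J (D.Kw w)) w :=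
    continuousAt_pi.mpr fun i => continuousAt_pi.mpr fun j =>
      (D.differentiableAt_entry hw i j).continuousAt
  exact (continuous_matrixOp.comp
    (Continuous.matrix_adjugate (A := fun B : Matrix (Fin D.m) (Fin D.m) ℂ => B)
      continuous_id)).continuousAt.comp h1

theorem inverse_pencil (hdet : D.det w ≠ 0) : IsUnit (pencil C z₀ w) ∧
    Ring.inverse (pencil C z₀ w) = D.G w * (1 + (D.det w)⁻¹ •
      (D.J ∘L matrixOp D.m (pencilMatrix D.J (D.Kw w)).adjugate ∘L D.Kw w)) := by
  obtain ⟨h1, h2⟩ := finiteRank_inverse D.J (D.Kw w) hdet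
  change (1 - _) * (1 + (D.det w)⁻¹ • _) = 1 at h1
  change (1 + (D.det w)⁻¹ • _) * (1 - _) = 1 at h2
  rw [D.pencil_eq hw]
  set X := 1 + (D.det w)⁻¹ •
      (D.J ∘L matrixOp D.m (pencilMatrix D.J (D.Kw w)).adjugate ∘L D.Kw w)
  have h3 : (1 - D.J ∘L D.Kw w) * pencil (C - D.J ∘L D.K) z₀ w * (D.G w * X) = 1 := by
    rw [mul_assoc, ← mul_assoc _ (D.G w), D.small_mul_G hw, one_mul, h1]
  have h4 : D.G w * X * ((1 - D.J ∘L D.Kw w) * pencil (C - D.J ∘L D.K) z₀ w) = 1 := by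
    rw [mul_assoc, ← mul_assoc X, h2, one_mul, D.G_mul_small hw]
  exact ⟨isUnit_of_two_sided h3 h4, ring_inverse_eq h3 h4⟩

theorem exists_ker (hdet : D.det w = 0) : ∃ x : H, x ≠ 0 ∧ pencil C z₀ w x = 0 := by
  obtain ⟨u, hu, hfix⟩ := exists_fixed_of_det_eq_zero D.J (D.Kw w) hdet
  have hsmall : pencil (C - D.J ∘L D.K) z₀ w (D.G w u) = u :=
    DFunLike.congr_fun (D.small_mul_G hw) u
  refine ⟨D.G w u, fun h => hu ?_, ?_⟩
  · rw [← hsmall, h, map_zero]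
  · rw [D.pencil_eq hw, mul_apply_eq_comp, hsmall]
    simp [hfix]

include D in
-- `K` is injective on the kernel: where `K x = 0`, the pencils of `C` and of the remainder agree,
-- and the latter is invertible.
theorem finiteDimensional_ker :
    FiniteDimensional ℂ (LinearMap.ker (pencil C z₀ w).toLinearMap) := by
  refine FiniteDimensional.of_injective
    ((D.K : H →ₗ[ℂ] Fin D.m → ℂ) ∘ₗ (LinearMap.ker (pencil C z₀ w).toLinearMap).subtype) ?_
  rw [← LinearMap.ker_eq_bot, LinearMap.ker_eq_bot']
  rintro ⟨x, hx⟩ hKx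
  have hx' : pencil C z₀ w x = 0 := hx
  have hKx' : D.K x = 0 := hKx
  have h1 : pencil (C - D.J ∘L D.K) z₀ w x = 0 := by
    simp only [pencil, sub_apply, smul_apply,
      ContinuousLinearMap.comp_apply, hKx', map_zero, sub_zero] at hx' ⊢
    exact hx'
  have h2 : D.G w (pencil (C - D.J ∘L D.K) z₀ w x) = x :=
    DFunLike.congr_fun (D.G_mul_small hw) x
  rw [h1, map_zero] at h2
  exact Subtype.ext h2.symm

omit hw
omit [CompleteSpace H]

/-- This keeps the determinant from vanishing identically on the ball. -/
theorem det_center : D.det z₀ = 1 := by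
  have : pencilMatrix D.J (D.Kw z₀) = 1 := by
    simp [pencilMatrix, Kw]
  rw [det, this, Matrix.det_one]

end LocalReduction
end Pencil

/-! ### Poles of the inverse pencil -/

section Pole

variable {H : Type*} [NormedAddCommGroup H] [NormedSpace ℂ H] [CompleteSpace H]

omit [CompleteSpace H] in
theorem FiniteRankApprox.exists_reduction {C : H →L[ℂ] H} (hC : FiniteRankApprox C) (z₀ z : ℂ) :
    ∃ ρ : ℝ, z₀ ∈ Metric.ball z₀ ρ ∧ z ∈ Metric.ball z₀ ρ ∧ Nonempty (LocalReduction C z₀ ρ) := by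
  have hρ : 0 < dist z z₀ + 1 := by positivity
  obtain ⟨m, J, K, h⟩ := hC (1 / (dist z z₀ + 1)) (by positivity)
  exact ⟨dist z z₀ + 1, Metric.mem_ball_self hρ, by simp [Metric.mem_ball], ⟨⟨m, J, K, h⟩⟩⟩

/-- The pencil is invertible in a punctured neighbourhood of every point, and its inverse has a
pole there. -/
theorem FiniteRankApprox.exists_pole {C : H →L[ℂ] H} (hC : FiniteRankApprox C) (z₀ z : ℂ) :
    ∃ (n : ℕ) (r : ℝ), 0 < r ∧
      (∀ w ∈ Metric.closedBall z r, w ≠ z → IsUnit (pencil C z₀ w)) ∧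
      ContinuousAt (fun w => (w - z) ^ (n + 1) • (C * Ring.inverse (pencil C z₀ w))) z := by
  obtain ⟨ρ, h₀, hz, ⟨D⟩⟩ := hC.exists_reduction z₀ z
  have hana : AnalyticOnNhd ℂ D.det (Metric.ball z₀ ρ) :=
    DifferentiableOn.analyticOnNhd
      (fun w hw => (D.differentiableAt_det hw).differentiableWithinAt) Metric.isOpen_ball
  have hne : ¬ ∀ᶠ w in 𝓝 z, D.det w = 0 := by
    intro h
    have := hana.eqOn_zero_of_preconnected_of_eventuallyEq_zero
      (convex_ball z₀ ρ).isPreconnected hz h h₀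
    rw [D.det_center] at this
    exact one_ne_zero this
  obtain ⟨n, g, hg, hgz, hdet⟩ := (hana z hz).exists_eventuallyEq_pow_smul_nonzero_iff.mpr hne
  have hball : ∀ᶠ w in 𝓝 z, w ∈ Metric.ball z₀ ρ := Metric.isOpen_ball.mem_nhds hz
  have hgne : ∀ᶠ w in 𝓝 z, g w ≠ 0 := hg.continuousAt.eventually_ne hgz
  have hall : ∀ᶠ w in 𝓝 z, w ≠ z → IsUnit (pencil C z₀ w) := by
    filter_upwards [hdet, hball, hgne] with w h1 h2 h3 hw
    refine (D.inverse_pencil h2 ?_).1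
    rw [h1]
    exact smul_ne_zero (pow_ne_zero _ (sub_ne_zero.mpr hw)) h3
  obtain ⟨r, hr, hrall⟩ := Metric.nhds_basis_closedBall.eventually_iff.mp hall
  refine ⟨n, r, hr, fun w hw => hrall hw, ?_⟩
  set N : ℂ → (Fin D.m → ℂ) →L[ℂ] (Fin D.m → ℂ) :=
    fun w => matrixOp D.m (pencilMatrix D.J (D.Kw w)).adjugate with hN
  -- The determinant vanishes to order `n`. The exponent `n + 1` makes both functions vanish at `z`
  -- itself, so the default value of `Ring.inverse` there does not matter.
  have hcont : ContinuousAt (fun w => C * (D.G w * ((w - z) ^ (n + 1) • (1 : H →L[ℂ] H) +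
      (w - z) • ((g w)⁻¹ • (D.J ∘L N w ∘L D.Kw w))))) z := by
    have h1 : ContinuousAt N z := D.continuousAt_adjugate hz
    have h2 : ContinuousAt D.Kw z := (D.differentiableAt_Kw hz).continuousAt
    have h3 : ContinuousAt D.G z := (D.differentiableAt_G hz).continuousAt
    have h4 : ContinuousAt (fun w => D.J ∘L N w ∘L D.Kw w) z :=
      continuousAt_const.clm_comp (h1.clm_comp h2)
    have h5 : ContinuousAt (fun w => (g w)⁻¹) z := hg.continuousAt.inv₀ hgz
    have h6 : ContinuousAt (fun w => w - z) z := by fun_prop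
    exact continuousAt_const.mul (h3.mul (((h6.pow _).smul continuousAt_const).add
      (h6.smul (h5.smul h4))))
  refine hcont.congr ?_
  filter_upwards [hdet, hball, hgne] with w h1 h2 h3
  rcases eq_or_ne w z with rfl | hw
  · simp
  · have hw' : w - z ≠ 0 := sub_ne_zero.mpr hw
    have h4 : D.det w ≠ 0 := by
      rw [h1]
      exact smul_ne_zero (pow_ne_zero _ hw') h3
    have h5 : (w - z) ^ (n + 1) * (D.det w)⁻¹ = (w - z) * (g w)⁻¹ := by
      rw [h1, smul_eq_mul]
      field_simp
      ring
    rw [(D.inverse_pencil h2 h4).2, ← mul_smul_comm, ← mul_smul_comm, smul_add,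
      smul_smul ((w - z) ^ (n + 1)), h5, mul_smul]

end Pole

/-! ### Operators with a resolvent that is a limit of finite-rank operators -/

section Discrete

variable {H : Type*} [NormedAddCommGroup H] [InnerProductSpace ℂ H]
variable {A : H →ₗ.[ℂ] H} {z₀ : ℂ} {C : H →L[ℂ] H}

/-- The two resolvent identities `R - C = (z₀ - w) C R = (z₀ - w) R C` make `1 + (z₀ - w) R` the
inverse of the pencil. -/
theorem IsResolventAt.isUnit_pencil (hC : IsResolventAt A z₀ C) {w : ℂ} {R : H →L[ℂ] H}
    (hR : IsResolventAt A w R) :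
    IsUnit (pencil C z₀ w) ∧ R = C * Ring.inverse (pencil C z₀ w) := by
  have h1 : R - (z₀ - w) • (C * R) = C := by
    ext f
    obtain ⟨hf, hfe⟩ := hR.1 f
    have h := hC.2 ⟨R f, hf⟩
    have h2 : z₀ • R f - A ⟨R f, hf⟩ = f + (z₀ - w) • R f := by
      have hA := congrArg (fun y => w • R f - y) hfe
      simp only [sub_sub_cancel] at hA
      rw [hA]
      module
    simp only [h2, map_add, map_smul] at h
    simp only [sub_apply, smul_apply, mul_apply_eq_comp]
    rw [sub_eq_iff_eq_add, h]
  have h2 : R - (z₀ - w) • (R * C) = C := by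
    ext f
    obtain ⟨hf, hfe⟩ := hC.1 f
    have h := hR.2 ⟨C f, hf⟩
    have h2 : w • C f - A ⟨C f, hf⟩ = f - (z₀ - w) • C f := by
      have hA := congrArg (fun y => z₀ • C f - y) hfe
      simp only [sub_sub_cancel] at hA
      rw [hA]
      module
    simp only [h2, map_sub, map_smul] at h
    simpa only [sub_apply, smul_apply, mul_apply_eq_comp] using h
  have h3 : pencil C z₀ w * (1 + (z₀ - w) • R) = 1 := by
    have : pencil C z₀ w * R = C := by
      rw [pencil, sub_mul, one_mul, smul_mul_assoc, h1]
    rw [mul_add, mul_one, mul_smul_comm, this, pencil]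
    abel
  have h4 : (1 + (z₀ - w) • R) * pencil C z₀ w = 1 := by
    have : R * pencil C z₀ w = C := by
      rw [pencil, mul_sub, mul_one, mul_smul_comm, h2]
    rw [add_mul, one_mul, smul_mul_assoc, this, pencil]
    abel
  refine ⟨isUnit_of_two_sided h3 h4, ?_⟩
  rw [ring_inverse_eq h3 h4, mul_add, mul_one, mul_smul_comm]
  exact (sub_eq_iff_eq_add.mp h1)

theorem IsResolventAt.of_isUnit_pencil (hC : IsResolventAt A z₀ C) {w : ℂ}
    (hu : IsUnit (pencil C z₀ w)) : w ∈ resolventSet A := by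
  set I := Ring.inverse (pencil C z₀ w)
  have h1 : pencil C z₀ w * I = 1 := Ring.mul_inverse_cancel _ hu
  have h2 : I * pencil C z₀ w = 1 := Ring.inverse_mul_cancel _ hu
  have hcomm : C * I = I * C := by
    have h3 : C * pencil C z₀ w = pencil C z₀ w * C := by simp [pencil, mul_sub, sub_mul]
    calc C * I = I * pencil C z₀ w * (C * I) := by rw [h2, one_mul]
      _ = I * (C * pencil C z₀ w) * I := by rw [h3]; simp only [mul_assoc]
      _ = I * C := by rw [mul_assoc, mul_assoc, h1, mul_one]
  refine ⟨C * I, fun f => ?_, fun u => ?_⟩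
  · obtain ⟨hf, hfe⟩ := hC.1 (I f)
    refine ⟨hf, ?_⟩
    have h3 : pencil C z₀ w (I f) = f := DFunLike.congr_fun h1 f
    simp only [pencil, sub_apply, one_apply_eq_self, smul_apply] at h3
    change w • C (I f) - A ⟨C (I f), hf⟩ = f
    have hA := congrArg (fun y => z₀ • C (I f) - y) hfe
    simp only [sub_sub_cancel] at hA
    rw [hA]
    refine Eq.trans ?_ h3
    module
  · have h3 := hC.2 u
    have h4 : w • (u : H) - A u = (z₀ • (u : H) - A u) - (z₀ - w) • (u : H) := by module
    rw [hcomm, mul_apply_eq_comp, h4, map_sub, map_smul, h3]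
    exact DFunLike.congr_fun h2 (u : H)

/-- This holds at every `w`: on the spectrum both sides take the default value `0`. -/
theorem IsResolventAt.resolvent_eq (hC : IsResolventAt A z₀ C) (w : ℂ) :
    resolvent A w = C * Ring.inverse (pencil C z₀ w) := by
  by_cases hw : w ∈ resolventSet A
  · exact (hC.isUnit_pencil (isResolventAt_resolvent hw)).2
  · rw [resolvent, dif_neg hw, Ring.inverse_non_unit _ (fun h => hw (hC.of_isUnit_pencil h)),
      mul_zero]

/-- A kernel vector satisfies `x = (z₀ - z) C x`, so it lies in the domain, and applying `z₀ - A`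
gives `A x = z x`. -/
theorem IsResolventAt.exists_eigenvector (hC : IsResolventAt A z₀ C) {z : ℂ} {x : H} (hx : x ≠ 0)
    (hker : pencil C z₀ z x = 0) : ∃ u : A.domain, (u : H) ≠ 0 ∧ A u = z • (u : H) := by
  obtain ⟨hf, hfe⟩ := hC.1 x
  have h1 : x = (z₀ - z) • C x := by
    simpa [pencil, sub_eq_zero] using hker
  refine ⟨(z₀ - z) • ⟨C x, hf⟩, ?_, ?_⟩
  · rw [Submodule.coe_smul, ← h1]
    exact hx
  · have h2 : A ⟨C x, hf⟩ = z₀ • C x - x := by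
      have hA := congrArg (fun y => z₀ • C x - y) hfe
      simpa only [sub_sub_cancel] using hA
    rw [A.map_smul, Submodule.coe_smul, ← h1, h2, smul_sub, smul_comm, ← h1]
    module

theorem circleIntegral_mul_left [CompleteSpace H] (X : H →L[ℂ] H) {f : ℂ → H →L[ℂ] H} {c : ℂ}
    {r : ℝ} (hf : CircleIntegrable f c r) :
    ∮ w in C(c, r), X * f w = X * ∮ w in C(c, r), f w := by
  have := (ContinuousLinearMap.mul ℂ (H →L[ℂ] H) X).intervalIntegral_comp_comm hf.out
  simp only [circleIntegral]
  simpa [mul_smul_comm] using this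

theorem finiteDimensional_ker_pow [CompleteSpace H] {E : H →L[ℂ] H}
    (hE : FiniteDimensional ℂ (LinearMap.ker E.toLinearMap)) (n : ℕ) :
    FiniteDimensional ℂ (LinearMap.ker (E ^ n).toLinearMap) := by
  induction n with
  | zero =>
    have : LinearMap.ker (E ^ 0).toLinearMap = ⊥ := by
      rw [LinearMap.ker_eq_bot']
      intro x hx
      simpa using hx
    rw [this]
    infer_instance
  | succ n ih =>
    have : (E ^ (n + 1)).toLinearMap = E.toLinearMap ∘ₗ (E ^ n).toLinearMap := by
      rw [pow_succ']
      rfl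
    rw [this, LinearMap.ker_comp]
    infer_instance

/-- `(1 - (z₀ - z) C)ⁿ` maps the integral of the resolvent to that of `(w - z)ⁿ R(w)`, up to a
power of `-C`. -/
theorem pencil_pow_mul_integral [CompleteSpace H] (hC : IsResolventAt A z₀ C) {z : ℂ} {r : ℝ}
    (hr : 0 < r) (hu : ∀ w ∈ Metric.sphere z r, IsUnit (pencil C z₀ w)) (n : ℕ) :
    pencil C z₀ z ^ n * ∮ w in C(z, r), resolvent A w =
      (-C) ^ n * ∮ w in C(z, r), (w - z) ^ n • resolvent A w := by
  have hcont : ContinuousOn (resolvent A) (Metric.sphere z r) := by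
    intro w hw
    have h1 : ContinuousAt (fun w => C * Ring.inverse (pencil C z₀ w)) w :=
      continuousAt_const.mul
        ((differentiableAt_inverse (hu w hw)).comp w (differentiable_pencil C z₀ w)).continuousAt
    exact (h1.congr (Eventually.of_forall fun w => (hC.resolvent_eq w).symm)).continuousWithinAt
  have hpow : ∀ n : ℕ, ContinuousOn (fun w : ℂ => (w - z) ^ n) (Metric.sphere z r) := fun n => by
    fun_prop
  have hint : ∀ n : ℕ, CircleIntegrable (fun w => (w - z) ^ n • resolvent A w) z r := fun n =>
    ((hpow _).smul hcont).circleIntegrable hr.le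
  have hconst : ∀ n : ℕ, ∮ w in C(z, r), (w - z) ^ n • C = 0 := fun n =>
    Complex.circleIntegral_eq_zero_of_differentiable_on_off_countable hr.le Set.countable_empty
      (by fun_prop) (fun w _ => by fun_prop)
  have hcomm : ∀ n : ℕ, pencil C z₀ z * (-C) ^ n = (-C) ^ n * pencil C z₀ z := by
    intro n
    have : Commute (pencil C z₀ z) (-C) := by
      simp only [Commute, SemiconjBy, pencil, mul_neg, neg_mul, mul_sub, sub_mul, one_mul, mul_one,
        mul_smul_comm, smul_mul_assoc]
      module
    exact this.pow_right n
  -- Since `pencil C z₀ w * R(w) = C`, one has `pencil C z₀ z * R(w) = C - (w - z) C R(w)`, and `(w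
  -- - z)ⁿ C` integrates to zero.
  have hstep : ∀ n : ℕ, pencil C z₀ z * ∮ w in C(z, r), (w - z) ^ n • resolvent A w =
      -C * ∮ w in C(z, r), (w - z) ^ (n + 1) • resolvent A w := by
    intro n
    rw [← circleIntegral_mul_left _ (hint n), ← circleIntegral_mul_left _ (hint (n + 1)),
      ← sub_eq_zero, ← circleIntegral.integral_sub]
    · rw [← hconst n]
      refine circleIntegral.integral_congr hr.le fun w hw => ?_
      have h1 : pencil C z₀ w * resolvent A w = C := by
        have h2 : pencil C z₀ w * C = C * pencil C z₀ w := by simp [pencil, mul_sub, sub_mul]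
        rw [hC.resolvent_eq, ← mul_assoc, h2, mul_assoc, Ring.mul_inverse_cancel _ (hu w hw),
          mul_one]
      have h3 : pencil C z₀ z = pencil C z₀ w - (w - z) • C := by
        simp only [pencil]
        module
      simp only [mul_smul_comm, neg_mul]
      rw [h3, sub_mul, h1, smul_mul_assoc, pow_succ]
      module
    · exact (continuousOn_const.mul
        ((hpow _).smul hcont)).circleIntegrable hr.le
    · exact (continuousOn_const.mul
        ((hpow _).smul hcont)).circleIntegrable hr.le
  induction n with
  | zero => simp
  | succ n ih =>
    rw [pow_succ', mul_assoc, ih, ← mul_assoc, hcomm, mul_assoc, hstep, pow_succ, mul_assoc]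

theorem hasDiscreteSpectrum_of_finiteRankApprox [CompleteSpace H] (hC : IsResolventAt A z₀ C)
    (hF : FiniteRankApprox C) : HasDiscreteSpectrum A := by
  have hsub : ∀ {z : ℂ} {r : ℝ}, (∀ w ∈ Metric.closedBall z r, w ≠ z → IsUnit (pencil C z₀ w)) →
      Metric.closedBall z r ∩ Sp A ⊆ {z} := by
    rintro z r hu w ⟨hw, hwS⟩
    by_contra hne
    exact hwS (hC.of_isUnit_pencil (hu w hw hne))
  refine ⟨fun z => ?_, fun z hz => ⟨?_, ?_⟩⟩
  · obtain ⟨n, r, hr, hu, -⟩ := hF.exists_pole z₀ z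
    exact ⟨r, hr, hsub hu⟩
  · obtain ⟨ρ, -, hzρ, ⟨D⟩⟩ := hF.exists_reduction z₀ z
    by_cases hdet : D.det z = 0
    · obtain ⟨x, hx, hker⟩ := D.exists_ker hzρ hdet
      exact hC.exists_eigenvector hx hker
    · exact absurd (hC.of_isUnit_pencil (D.inverse_pencil hzρ hdet).1) hz
  · obtain ⟨n, r, hr, hu, hpole⟩ := hF.exists_pole z₀ z
    refine ⟨r, hr, (hsub hu).antisymm ?_, ?_⟩
    · rintro _ rfl
      exact ⟨Metric.mem_closedBall_self hr.le, hz⟩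
    have hRdiff : ∀ w ∈ Metric.closedBall z r, w ≠ z → DifferentiableAt ℂ
        (fun w => (w - z) ^ (n + 1) • (C * Ring.inverse (pencil C z₀ w))) w := by
      intro w hw hne
      have h1 : DifferentiableAt ℂ (fun w => C * Ring.inverse (pencil C z₀ w)) w :=
        (differentiableAt_const C).mul
          ((differentiableAt_inverse (hu w hw hne)).comp w (differentiable_pencil C z₀ w))
      exact (show DifferentiableAt ℂ (fun w : ℂ => (w - z) ^ (n + 1)) w by fun_prop).smul h1
    -- The factor removes the pole: continuity at `z` and holomorphy elsewhere suffice for Cauchy's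
    -- theorem.
    have hzero : ∮ w in C(z, r), (w - z) ^ (n + 1) • resolvent A w = 0 := by
      simp only [hC.resolvent_eq]
      refine Complex.circleIntegral_eq_zero_of_differentiable_on_off_countable hr.le
        (Set.countable_singleton z) (fun w hw => ?_) (fun w hw => ?_)
      · rcases eq_or_ne w z with rfl | hne
        · exact hpole.continuousWithinAt
        · exact (hRdiff w hw hne).continuousAt.continuousWithinAt
      · exact hRdiff w (Metric.ball_subset_closedBall hw.1) hw.2
    have hpow := pencil_pow_mul_integral hC hr (z := z)
      (fun w hw => hu w (Metric.sphere_subset_closedBall hw) (fun h => by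
        rw [h, Metric.mem_sphere, dist_self] at hw
        exact hr.ne hw)) (n + 1)
    rw [hzero, mul_zero] at hpow
    have hker : FiniteDimensional ℂ (LinearMap.ker (pencil C z₀ z).toLinearMap) := by
      obtain ⟨ρ, -, hzρ, ⟨D⟩⟩ := hF.exists_reduction z₀ z
      exact D.finiteDimensional_ker hzρ
    have := finiteDimensional_ker_pow hker (n + 1)
    refine Submodule.finiteDimensional_of_le
      (S₂ := LinearMap.ker (pencil C z₀ z ^ (n + 1)).toLinearMap) ?_
    rintro _ ⟨f, rfl⟩
    have h := DFunLike.congr_fun hpow f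
    rw [LinearMap.mem_ker]
    change (pencil C z₀ z ^ (n + 1)) (rieszProjection A z r f) = 0
    rw [rieszProjection, smul_apply, map_smul]
    change _ • ((pencil C z₀ z ^ (n + 1) * ∮ w in C(z, r), resolvent A w) f) = 0
    rw [h]
    simp

end Discrete

section DiagonalOperators

variable {H : Type*} [NormedAddCommGroup H] [InnerProductSpace ℂ H]

/-! ### Diagonal operators -/

theorem hilbertBasis_sum_norm_le (φ : HilbertBasis ℕ+ ℂ H) {v : ℕ+ → H}
    (hv : Summable fun k => ‖v k‖ ^ 2) (f : H) :
    Summable (fun k => ‖φ.repr f k • v k‖) ∧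
      ∑' k, ‖φ.repr f k • v k‖ ≤ √(∑' k, ‖v k‖ ^ 2) * ‖f‖ := by
  have key : ∀ s : Finset ℕ+, ∑ k ∈ s, ‖φ.repr f k • v k‖ ≤ √(∑' k, ‖v k‖ ^ 2) * ‖f‖ := by
    intro s
    have h1 : ∑ k ∈ s, ‖φ.repr f k‖ ^ 2 ≤ ‖f‖ ^ 2 := by
      simp only [φ.repr_apply_apply]
      exact φ.orthonormal.sum_inner_products_le f
    have h2 : ∑ k ∈ s, ‖v k‖ ^ 2 ≤ ∑' k, ‖v k‖ ^ 2 :=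
      hv.sum_le_tsum s fun k _ => sq_nonneg _
    simp only [norm_smul]
    refine (Real.sum_mul_le_sqrt_mul_sqrt s _ _).trans ?_
    rw [mul_comm]
    refine mul_le_mul (Real.sqrt_le_sqrt h2) ?_ (Real.sqrt_nonneg _) (Real.sqrt_nonneg _)
    exact (Real.sqrt_le_sqrt h1).trans_eq (Real.sqrt_sq (norm_nonneg f))
  have hs := summable_of_sum_le (fun k => norm_nonneg _) key
  exact ⟨hs, hs.tsum_le_of_sum_le key⟩

section Resolvent

variable {T B : H →ₗ.[ℂ] H} {t : ℕ → ℝ} {φ : HilbertBasis ℕ+ ℂ H} {hφ : ∀ k, φ k ∈ T.domain}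
  {z : ℂ} {R : H →L[ℂ] H}

theorem IsResolventAt.hasSum_diagonal (hTφ : ∀ k : ℕ+, T ⟨φ k, hφ k⟩ = (t k : ℂ) • φ k)
    (hR : IsResolventAt T z R) (hz : ∀ k : ℕ+, z ≠ t k) (f : H) :
    HasSum (fun k : ℕ+ => φ.repr f k • ((z - t k)⁻¹ • φ k)) (R f) := by
  have h1 : ∀ k : ℕ+, R (φ k) = (z - t k)⁻¹ • φ k := by
    intro k
    have h2 := hR.2 ⟨φ k, hφ k⟩
    rw [hTφ] at h2
    change R (z • φ k - (t k : ℂ) • φ k) = φ k at h2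
    rw [← sub_smul, map_smul] at h2
    rwa [eq_inv_smul_iff₀ (sub_ne_zero.mpr (hz k))]
  simpa [h1] using (φ.hasSum_repr f).mapL R

/-- The Hilbert–Schmidt bound: truncating the diagonal expansion to `s` leaves an error of norm at
most the root of the tail of `∑ 1/‖z - t k‖²`. -/
theorem IsResolventAt.finiteRankApprox [CompleteSpace H]
    (hTφ : ∀ k : ℕ+, T ⟨φ k, hφ k⟩ = (t k : ℂ) • φ k)
    (hR : IsResolventAt T z R) (hz : ∀ k : ℕ+, z ≠ t k)
    (hsum : Summable fun k : ℕ+ => 1 / ‖z - t k‖ ^ 2) : FiniteRankApprox R := by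
  intro ε hε
  have hv : ∀ k : ℕ+, ‖(z - t k)⁻¹ • φ k‖ ^ 2 = 1 / ‖z - t k‖ ^ 2 := by
    intro k
    rw [norm_smul, φ.orthonormal.1 k, mul_one, norm_inv, inv_pow, one_div]
  obtain ⟨s, hs⟩ := ((tendsto_tsum_compl_atTop_zero fun k : ℕ+ => 1 / ‖z - t k‖ ^ 2)
    |>.eventually_lt_const (show 0 < (ε / 2) ^ 2 by positivity)).exists
  set e := s.equivFin
  set J : (Fin s.card → ℂ) →L[ℂ] H :=
    ∑ i, (ContinuousLinearMap.proj (R := ℂ) (φ := fun _ : Fin s.card => ℂ) i).smulRight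
      (φ (e.symm i : ℕ+)) with hJ
  set K : H →L[ℂ] (Fin s.card → ℂ) :=
    ContinuousLinearMap.pi fun i => (z - t (e.symm i : ℕ+))⁻¹ • innerSL ℂ (φ (e.symm i : ℕ+))
    with hK
  refine ⟨s.card, J, K, ?_⟩
  have hJK : ∀ f, J (K f) = ∑ k ∈ s, φ.repr f k • ((z - t k)⁻¹ • φ k) := by
    intro f
    rw [← Finset.sum_coe_sort s, ← e.symm.sum_comp]
    simp only [hJ, hK, sum_apply, ContinuousLinearMap.smulRight_apply,
      ContinuousLinearMap.proj_apply, ContinuousLinearMap.pi_apply, smul_apply,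
      innerSL_apply_apply, φ.repr_apply_apply]
    refine Finset.sum_congr rfl fun i _ => ?_
    rw [smul_smul, smul_eq_mul, mul_comm]
  set v : ℕ+ → H := fun k => if k ∈ s then 0 else (z - t k)⁻¹ • φ k with hvdef
  have hvn : (fun k => ‖v k‖ ^ 2) =
      Set.indicator {k | k ∉ s} fun k : ℕ+ => 1 / ‖z - t k‖ ^ 2 := by
    ext k
    by_cases hk : k ∈ s
    · simp [hvdef, hk]
    · rw [Set.indicator_of_mem (by exact hk), ← hv k]
      simp only [hvdef, hk, if_false]
  have hvs : Summable fun k => ‖v k‖ ^ 2 := by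
    rw [hvn]
    exact hsum.indicator _
  have hvt : ∑' k, ‖v k‖ ^ 2 < (ε / 2) ^ 2 := by
    rw [hvn, ← tsum_subtype]
    exact hs
  have hbound : ∀ f, ‖(R - J ∘L K) f‖ ≤ ε / 2 * ‖f‖ := by
    intro f
    obtain ⟨h1, h2⟩ := hilbertBasis_sum_norm_le φ hvs f
    have h3 : HasSum (fun k => φ.repr f k • v k) ((R - J ∘L K) f) := by
      have h4 : HasSum (fun k : ℕ+ => if k ∈ s then φ.repr f k • ((z - t k)⁻¹ • φ k) else 0)
          (J (K f)) := by
        rw [hJK, ← Finset.sum_congr rfl fun k hk => if_pos hk]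
        exact hasSum_sum_of_ne_finset_zero fun k hk => if_neg hk
      refine ((hR.hasSum_diagonal hTφ hz f).sub h4).congr_fun fun k => ?_
      by_cases hk : k ∈ s <;> simp [hvdef, hk]
    rw [← h3.tsum_eq]
    refine (norm_tsum_le_tsum_norm h1).trans (h2.trans ?_)
    refine mul_le_mul_of_nonneg_right ?_ (norm_nonneg f)
    exact Real.sqrt_le_iff.mpr ⟨by positivity, hvt.le⟩
  exact (ContinuousLinearMap.opNorm_le_bound _ (by positivity) hbound).trans_lt (by linarith)

theorem FiniteRankApprox.mul_right {C : H →L[ℂ] H} (hC : FiniteRankApprox C) (Q : H →L[ℂ] H) :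
    FiniteRankApprox (C * Q) := by
  intro ε hε
  obtain ⟨m, J, K, h⟩ := hC (ε / (‖Q‖ + 1)) (by positivity)
  refine ⟨m, J, K ∘L Q, ?_⟩
  have h1 : C * Q - J ∘L K ∘L Q = (C - J ∘L K) ∘L Q := by
    ext f
    simp
  rw [h1]
  rw [lt_div_iff₀ (by positivity)] at h
  refine ((C - J ∘L K).opNorm_comp_le Q).trans_lt ?_
  nlinarith [norm_nonneg (C - J ∘L K)]

/-- A closed operator composed with the resolvent of a diagonal operator. -/
theorem IsResolventAt.norm_closed_comp_le [CompleteSpace H]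
    (hTφ : ∀ k : ℕ+, T ⟨φ k, hφ k⟩ = (t k : ℂ) • φ k)
    (hR : IsResolventAt T z R) (hz : ∀ k : ℕ+, z ≠ t k) (hB : B.IsClosed)
    (hTB : T.domain ≤ B.domain)
    (hs : Summable fun k : ℕ+ => betaSeq B φ (fun k => hTB (hφ k)) k / ‖z - t k‖ ^ 2)
    (hle : ∑' k : ℕ+, betaSeq B φ (fun k => hTB (hφ k)) k / ‖z - t k‖ ^ 2 ≤ 1 / 4)
    (f : H) (hf : R f ∈ B.domain) : ‖B ⟨R f, hf⟩‖ ≤ 1 / 2 * ‖f‖ := by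
  set v : ℕ+ → H := fun k => (z - t k)⁻¹ • B ⟨φ k, hTB (hφ k)⟩ with hv
  have hvn : (fun k => ‖v k‖ ^ 2) =
      fun k : ℕ+ => betaSeq B φ (fun k => hTB (hφ k)) k / ‖z - t k‖ ^ 2 := by
    ext k
    rw [hv, norm_smul, norm_inv, mul_pow, inv_pow, betaSeq, mul_comm, div_eq_mul_inv]
  obtain ⟨h1, h2⟩ := hilbertBasis_sum_norm_le φ (v := v) (by rwa [hvn]) f
  have hsum : HasSum (fun k => φ.repr f k • v k) (∑' k, φ.repr f k • v k) :=
    h1.of_norm.hasSum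
  -- The partial sums lie in the graph of `B`, and both coordinates converge.
  have hmem : (R f, ∑' k, φ.repr f k • v k) ∈ (B.graph : Set (H × H)) := by
    have hlim := (hR.hasSum_diagonal hTφ hz f).prodMk_nhds hsum
    refine IsClosed.mem_of_tendsto hB hlim (Eventually.of_forall fun s => ?_)
    have h3 : (∑ k ∈ s, φ.repr f k • ((z - t k)⁻¹ • φ k), ∑ k ∈ s, φ.repr f k • v k) =
        ∑ k ∈ s, φ.repr f k • ((z - t k)⁻¹ • (φ k, B ⟨φ k, hTB (hφ k)⟩)) := by
      ext
      · simp [Prod.fst_sum]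
      · simp [Prod.snd_sum, hv]
    rw [SetLike.mem_coe, h3]
    exact Submodule.sum_mem _ fun k _ => Submodule.smul_mem _ _ (Submodule.smul_mem _ _
      (B.mem_graph ⟨φ k, hTB (hφ k)⟩))
  obtain ⟨y, hy1, hy2⟩ := B.mem_graph_iff.mp hmem
  have hy : y = ⟨R f, hf⟩ := Subtype.ext hy1
  rw [hy] at hy2
  rw [hy2]
  refine (norm_tsum_le_tsum_norm h1).trans (h2.trans ?_)
  refine mul_le_mul_of_nonneg_right ?_ (norm_nonneg f)
  rw [hvn]
  exact Real.sqrt_le_iff.mpr ⟨by norm_num, hle.trans_eq (by norm_num)⟩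

/-- If `‖B R(z)‖ ≤ 1/2`, then `R(z) (1 - B R(z))⁻¹` is the resolvent of `T + B`. -/
theorem IsResolventAt.exists_perturbed [CompleteSpace H] (hR : IsResolventAt T z R)
    (hTB : T.domain ≤ B.domain)
    (hle : ∀ f (hf : R f ∈ B.domain), ‖B ⟨R f, hf⟩‖ ≤ 1 / 2 * ‖f‖) :
    ∃ Q : H →L[ℂ] H, IsResolventAt (T + B) z (R * Q) := by
  have hdom : ∀ f, R f ∈ B.domain := fun f => hTB (hR.1 f).1
  set X : H →L[ℂ] H := LinearMap.mkContinuous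
    (B.toFun ∘ₗ LinearMap.codRestrict B.domain (R : H →ₗ[ℂ] H) hdom) (1 / 2)
    (fun f => hle f (hdom f)) with hX
  have hXapply : ∀ f, X f = B ⟨R f, hdom f⟩ := fun f => rfl
  have hu : IsUnit (1 - X) := isUnit_one_sub_of_norm_lt_one
    ((LinearMap.mkContinuous_norm_le _ (by norm_num) _).trans_lt (by norm_num))
  refine ⟨Ring.inverse (1 - X), fun f => ?_, fun u => ?_⟩
  · set g := Ring.inverse (1 - X) f
    have hg : g - X g = f := DFunLike.congr_fun (Ring.mul_inverse_cancel _ hu) f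
    obtain ⟨hT, hTe⟩ := hR.1 g
    refine ⟨⟨hT, hdom g⟩, ?_⟩
    change z • R g - (T ⟨R g, hT⟩ + B ⟨R g, hdom g⟩) = f
    rw [← hXapply, ← sub_sub, hTe, hg]
  · obtain ⟨u, huT, huB⟩ := u
    have h1 : R (z • u - T ⟨u, huT⟩) = u := hR.2 ⟨u, huT⟩
    set g := z • u - T ⟨u, huT⟩ with hg
    have h2 : X g = B ⟨u, huB⟩ := by
      rw [hXapply]
      congr 1
      exact Subtype.ext h1
    change R (Ring.inverse (1 - X) (z • u - (T ⟨u, huT⟩ + B ⟨u, huB⟩))) = u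
    rw [← sub_sub, ← hg, ← h2]
    have h3 : Ring.inverse (1 - X) (g - X g) = g :=
      DFunLike.congr_fun (Ring.inverse_mul_cancel _ hu) g
    rw [h3, h1]

end Resolvent

end DiagonalOperators

/-! ### Assembling the proof -/

/-- Without boundedness the real supremum in `Admissible` would be the default `0` and bound
nothing. -/
theorem bddAbove_range_of_eventually_le {β : ℕ+ → ℝ} {c : ℝ} (h : ∀ᶠ k in atTop, β k ≤ c) :
    BddAbove (Set.range β) := by
  obtain ⟨M, hM⟩ := eventually_atTop.mp h
  refine (((Set.finite_Iio M).image β).bddAbove.union (bddAbove_Iic (a := c))).mono ?_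
  rintro _ ⟨k, rfl⟩
  rcases lt_or_ge k M with hk | hk
  · exact Or.inl ⟨k, hk, rfl⟩
  · exact Or.inr (hM k hk)

/-- The region has bounded height. A point `i c` on the imaginary axis is convenient because `|i c -
t_k|² = c² + t_k²`, the form in `separated_sum_le` with `a = 0`. -/
theorem exists_notMem_spectralRegion (t : ℕ → ℝ) (p : ℕ) {d : ℝ} (hd : 0 < d) (K : ℕ) {h : ℝ}
    (hh : 0 < h) : ∃ c : ℝ, 0 < c ∧ Complex.I * c ∉ spectralRegion t p d K h := by
  have hδ : 0 ≤ d / (2 * p) := by positivity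
  refine ⟨h + d / (2 * p) + 1, by positivity, ?_⟩
  have him : |(Complex.I * ((h + d / (2 * p) + 1 : ℝ) : ℂ)).im| = h + d / (2 * p) + 1 := by
    rw [Complex.I_mul_im, Complex.ofReal_re, abs_of_pos (by positivity)]
  simp only [spectralRegion, Set.mem_union, Set.mem_iUnion, not_or, not_exists]
  refine ⟨fun hz => ?_, fun j _ hz => ?_⟩
  · have := hz.2.2
    rw [him] at this
    linarith
  · have := hz.2
    rw [him] at this
    linarith

end SpectralPerturbation

end

open SpectralPerturbation in
theorem propositionA {H : Type*} [NormedAddCommGroup H] [InnerProductSpace ℂ H] [CompleteSpace H]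
    (T B : H →ₗ.[ℂ] H)
    -- the self-adjoint operator `T`, its spectrum and its orthonormal basis of eigenvectors
    (hT : IsSelfAdjoint T)
    (t : ℕ → ℝ) (φ : HilbertBasis ℕ+ ℂ H)
    (hφ : ∀ k, φ k ∈ T.domain)
    (hTφ : ∀ k : ℕ+, T ⟨φ k, hφ k⟩ = (t k : ℂ) • φ k)
    (hspec : Sp T = Set.range fun k : ℕ+ => (t k : ℂ))
    (hmono : ∀ k : ℕ, 1 ≤ k → t k < t (k + 1))
    (p : ℕ) (hp : 1 ≤ p) (d : ℝ) (hd : 0 < d)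
    (hgap : ∀ k : ℕ, 1 ≤ k → d < t (k + p) - t k)
    -- the perturbation
    (hB : B.IsClosed) (hTB : T.domain ≤ B.domain)
    (hlim : limsup (fun k : ℕ+ => (betaSeq B φ (fun k => hTB (hφ k)) k : EReal)) atTop
      < (betaBound p d : EReal)) :
    (∃ (M N : ℕ) (h : ℝ), Admissible (betaSeq B φ fun k => hTB (hφ k)) p d M N h) ∧
    ∀ (M N : ℕ) (h : ℝ), Admissible (betaSeq B φ fun k => hTB (hφ k)) p d M N h →
      HasDiscreteSpectrum (T + B) ∧
      Sp (T + B) ⊆ spectralRegion t p d (M + N) h ∧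
      ∀ z ∉ spectralRegion t p d (M + N) h,
        z ∈ resolventSet T ∧
        ∀ f : H, ∃ hf : resolvent T z f ∈ B.domain,
          ‖B ⟨resolvent T z f, hf⟩‖ ≤ 1 / 2 * ‖f‖ 
:= by
  have hβ : ∀ k, 0 ≤ betaSeq B φ (fun k => hTB (hφ k)) k := fun k => sq_nonneg _
  have hev : ∀ᶠ k in atTop, betaSeq B φ (fun k => hTB (hφ k)) k ≤ betaBound p d := by
    filter_upwards [eventually_lt_of_limsup_lt hlim] with k hk
    exact (EReal.coe_lt_coe_iff.mp hk).le
  refine ⟨exists_admissible hβ hp hd hev, fun M N h hadm => ?_⟩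
  have hT_mem : ∀ z : ℂ, (∀ k : ℕ+, z ≠ t k) → z ∈ resolventSet T := by
    intro z hz
    by_contra hcon
    have h1 : z ∈ Sp T := hcon
    rw [hspec] at h1
    obtain ⟨k, hk⟩ := h1
    exact hz k hk.symm
  have hout : ∀ z ∉ spectralRegion t p d (M + N) h, (∀ k : ℕ+, z ≠ t k) ∧
      IsResolventAt T z (resolvent T z) ∧
      ∀ f (hf : resolvent T z f ∈ B.domain), ‖B ⟨resolvent T z f, hf⟩‖ ≤ 1 / 2 * ‖f‖ := by
    intro z hz
    obtain ⟨hne, hs, hle⟩ := weighted_sum_le hmono hp hd hgap hβ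
      (bddAbove_range_of_eventually_le hev) hadm hz
    have hR := isResolventAt_resolvent (hT_mem z hne)
    exact ⟨hne, hR, hR.norm_closed_comp_le hTφ hne hB hTB hs hle⟩
  refine ⟨?_, ?_, ?_⟩
  · obtain ⟨c, hc, hz⟩ := exists_notMem_spectralRegion t p hd (M + N) hadm.2.2.1
    obtain ⟨hne, hR, hle⟩ := hout _ hz
    obtain ⟨Q, hQ⟩ := hR.exists_perturbed hTB hle
    refine hasDiscreteSpectrum_of_finiteRankApprox hQ
      ((hR.finiteRankApprox hTφ hne ?_).mul_right Q)
    refine (separated_sum_le hmono hp hd hgap 0 hc).1.congr fun k => ?_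
    rw [← Complex.normSq_eq_norm_sq, Complex.normSq_apply]
    simp
    ring
  · intro z hz
    by_contra hcon
    obtain ⟨-, hR, hle⟩ := hout z hcon
    obtain ⟨Q, hQ⟩ := hR.exists_perturbed hTB hle
    exact hz ⟨_, hQ⟩
  · intro z hz
    obtain ⟨hne, hR, hle⟩ := hout z hz
    exact ⟨hT_mem z hne, fun f => ⟨hTB (hR.1 f).1, hle f _⟩⟩
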